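/- Let $\mathbb X,\mathbb Y,\mathbb Z,\mathbb S$ be finite alphabets, $\mathbb S\neq\emptyset$. A *type* on a finite alphabet is the empirical distribution of some finite nonempty sequence (equivalently, a rational-valued PMF); $\mathbf P^e(\cdot)$ denotes the set of types. A *conditional type* on $B$ given $A$ is a conditional PMF of the form $J(b|a)=N_o(a,b|\mathbf x,\mathbf y)/N_o(a|\mathbf x)$ for sequences $\mathbf x,\mathbf y$ of equal length in which every $a\in A$ occurs in $\mathbf x$, where $N_o$ counts occurrences (equivalently, a rational-valued conditional PMF). Let $p_{Y,Z|X,S}$ be a compound discrete memoryless channel, with input $X$, outputs $Y$ (seen by the decoder) and $Z$ (interference seen by an external observer) and state $S$ fixed during the block and unknown to encoder and decoder, and assume that $p_{Y,Z|X,S}$ is a conditional type on $\mathbb Y\times\mathbb Z$ given $\mathbb X\times\mathbb S$. For $s\in\mathbb S$ let $J_s=p_{Y|X,S}(\cdot|\cdot,s)$ and $K_s=p_{Z|X,S}(\cdot|\cdot,s)$ be its marginal channels. A $(2^{nR},n)$-code, $R\ge 0$, consists of an encoder $\{1,\dots,\lceil 2^{nR}\rceil\}\to\mathbb X^n$ and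 a decoder $\mathbb Y^n\to\{1,\dots,\lceil 2^{nR}\rceil\}$; the message $M$ is uniform. The rate $R\ge0$ is *multiply achievable* with the types $(Q_s)_{s\in\mathbb S}\in\mathbf P^e(\mathbb Z)^{\mathbb S}$ if there is a sequence of $(2^{nR},n)$-codes such that $\lim_{n\to\infty}\max_{s}\Pr(\hat M\ne M\mid s)=0$ and, for every $s$, if the state is $s$, then $\sum_{c\in\mathbb Z}|Q_s(c)-P_{\mathbf z}(c)|\to0$ in probability, where $P_{\mathbf z}$ is the type of the interference sequence $\mathbf z\in\mathbb Z^n$. The communication–multiple-interference capacity region $C$ is the closure in $\mathbb R\times(\mathbb R^{\mathbb Z})^{\mathbb S}$ of the set of all tuples $(R,(Q_s)_{s})$ such that $R$ is multiply achievable with $(Q_s)_s$. For $Q\in\mathbf P^e(\mathbb Z)$ let $\mathbf P_{pim}(Q,K_s)=\{N\in\mathbf P^e(\mathbb X):\sum_a N(a)K_s(\cdot|a)=Q\}$, and let $I(NJ_s)$ be the mutual information, in bits, of the joint distribution $N(a)J_s(b|a)$. **Theorem.** The region $C$ is the closure of the set of all tuples $(R,(Q_s)_{s})$ with $R\ge0$,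 $Q_s\in\mathbf P^e(\mathbb Z)$ for all $s$, $\bigcap_{s}\mathbf P_{pim}(Q_s,K_s)\neq\emptyset$ and $$R\le\sup_{N\in\bigcap_{s}\mathbf P_{pim}(Q_s,K_s)}\ \min_{s\in\mathbb S}I(NJ_s).$$ Moreover, for every $(Q_s)_s\in\mathbf P^e(\mathbb Z)^{\mathbb S}$ with $\bigcap_{s}\mathbf P_{pim}(Q_s,K_s)\neq\emptyset$, this supremum is finite and equals the maximum, which is attained, of $\min_s I(NJ_s)$ over all (real-valued) PMFs $N$ on $\mathbb X$ with $\sum_aN(a)K_s(\cdot|a)=Q_s$ for every $s$. -/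

import Mathlib

noncomputable section

namespace CompoundInterference

open Filter Topology

/-! ### Types and conditional types -/

open Classical in
/-- Number of occurrences of the symbol `a` in the sequence `x`. -/
def occ {A : Type*} {n : ℕ} (x : Fin n → A) (a : A) : ℕ :=
  (Finset.univ.filter fun i => x i = a).card

/-- The type (empirical distribution) of a sequence. -/
def seqType {A : Type*} {n : ℕ} (x : Fin n → A) : A → ℝ :=
  fun a => (occ x a : ℝ) / (n : ℝ)

/-- The set of all types on `A`, with arbitrary positive denominator. -/
def types (A : Type*) : Set (A → ℝ) :=
  {P | ∃ n : ℕ, 0 < n ∧ ∃ x : Fin n → A, P = seqType x}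

/-- The set of all conditional types on `B` given `A` that are defined at every symbol of `A`:
`J(b|a)` is the number of occurrences of `(a, b)` in a pair of sequences of equal positive length
divided by the number of occurrences of `a`, and every `a` occurs. -/
def condTypes (A B : Type*) : Set (A → B → ℝ) :=
  {J | ∃ n : ℕ, 0 < n ∧ ∃ (x : Fin n → A) (y : Fin n → B), (∀ a, 0 < occ x a) ∧
    ∀ a b, J a b = (occ (fun i => (x i, y i)) (a, b) : ℝ) / (occ x a : ℝ)}

/-- The set of all probability mass functions on a finite alphabet. -/
def pmfs (A : Type*) [Fintype A] : Set (A → ℝ) :=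
  {P | (∀ a, 0 ≤ P a) ∧ ∑ a, P a = 1}

/-- Variational distance. -/
def variational {A : Type*} [Fintype A] (P Q : A → ℝ) : ℝ := ∑ a, |P a - Q a|

/-- The output distribution `∑ₐ N(a) K(·|a)`. -/
def output {A B : Type*} [Fintype A] (N : A → ℝ) (K : A → B → ℝ) : B → ℝ :=
  fun b => ∑ a, N a * K a b

/-- The pre-image of `Q` under `K`: all types `N` on the input alphabet whose output
distribution is `Q`. -/
def preimage {A B : Type*} [Fintype A] (Q : B → ℝ) (K : A → B → ℝ) : Set (A → ℝ) :=
  {N | N ∈ types A ∧ output N K = Q}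

/-- The joint distribution `N J` on `A × B`. -/
def joint {A B : Type*} (N : A → ℝ) (J : A → B → ℝ) : A × B → ℝ :=
  fun ab => N ab.1 * J ab.1 ab.2

/-- Mutual information (in bits) of a joint distribution: the divergence from the product of
its marginals. -/
def mutualInfo {A B : Type*} [Fintype A] [Fintype B] (P : A × B → ℝ) : ℝ :=
  ∑ a, ∑ b, P (a, b) * Real.logb 2 (P (a, b) / ((∑ b', P (a, b')) * ∑ a', P (a', b)))

/-! ### Compound channel and codes

A compound channel is a function `p`, where `p (a, s) (b, c)` is the probability of the output
pair `(b, c)` given input `a` in state `s`. -/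

/-- Marginal channel from the input to the receiver's output, in state `s`. -/
def chanY {X Y Z S : Type*} [Fintype Z] (p : X × S → Y × Z → ℝ) (s : S) : X → Y → ℝ :=
  fun a b => ∑ c, p (a, s) (b, c)

/-- Marginal channel from the input to the interference observed externally, in state `s`. -/
def chanZ {X Y Z S : Type*} [Fintype Y] (p : X × S → Y × Z → ℝ) (s : S) : X → Z → ℝ :=
  fun a c => ∑ b, p (a, s) (b, c)

/-- A code of blocklength `n` with `M` messages. -/
structure Code (X Y : Type*) (M n : ℕ) where
  enc : Fin M → Fin n → X
  dec : (Fin n → Y) → Fin M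

/-- Number of messages of a `(2^{nR}, n)` code, `⌈2^{nR}⌉`. -/
def numMessages (R : ℝ) (n : ℕ) : ℕ := ⌈(2 : ℝ) ^ ((n : ℝ) * R)⌉₊

open Classical in
/-- Probability of the event `E` (on message, receiver's sequence, interference sequence) when the
message is uniform, the code `c` is used, and the memoryless channel is in the same state `s`
during the whole block. -/
def prob {X Y Z S : Type*} [Fintype Y] [Fintype Z] (p : X × S → Y × Z → ℝ) (s : S)
    {M n : ℕ} (c : Code X Y M n) (E : Fin M → (Fin n → Y) → (Fin n → Z) → Prop) : ℝ :=
  (∑ m, ∑ y : Fin n → Y, ∑ z : Fin n → Z,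
    if E m y z then ∏ i, p (c.enc m i, s) (y i, z i) else 0) / (M : ℝ)

/-- The rate `R` is multiply achievable with the tuple `Q` of interference types: some sequence
of `(2^{nR}, n)` codes has error probability, maximised over the states, tending to `0`, and
in each state `s` the type of the interference sequence tends to `Q s` in probability. The
encoder and the decoder do not depend on the state. -/
def MultiplyAchievable {X Y Z S : Type*} [Fintype Y] [Fintype Z]
    (p : X × S → Y × Z → ℝ) (R : ℝ) (Q : S → Z → ℝ) : Prop :=
  ∃ c : (n : ℕ) → Code X Y (numMessages R n) n,
    Tendsto (fun n => ⨆ s, prob p s (c n) fun m y _ => (c n).dec y ≠ m) atTop (𝓝 0) ∧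
    ∀ s, ∀ ε > 0,
      Tendsto (fun n => prob p s (c n) fun _ _ z => ε ≤ variational (Q s) (seqType z))
        atTop (𝓝 0)

/-- The communication–multiple-interference capacity region, a closed subset of
`ℝ × (S → Z → ℝ)`. -/
def capacityRegion {X Y Z S : Type*} [Fintype Y] [Fintype Z]
    (p : X × S → Y × Z → ℝ) : Set (ℝ × (S → Z → ℝ)) :=
  closure {t | 0 ≤ t.1 ∧ (∀ s, t.2 s ∈ types Z) ∧ MultiplyAchievable p t.1 t.2}

/-- The intersection over the states of the pre-images of the interference types. -/
def commonPreimage {X Y Z S : Type*} [Fintype X] [Fintype Y]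
    (p : X × S → Y × Z → ℝ) (Q : S → Z → ℝ) : Set (X → ℝ) :=
  ⋂ s, preimage (Q s) (chanZ p s)

/-- The least mutual information over the states for the input distribution `N`. -/
def minInfo {X Y Z S : Type*} [Fintype X] [Fintype Y] [Fintype Z]
    (p : X × S → Y × Z → ℝ) (N : X → ℝ) : ℝ :=
  ⨅ s, mutualInfo (joint N (chanY p s))

end CompoundInterference

end

noncomputable section

namespace CompoundInterference

open Filter Topology

/-! ### Sums over product distributions -/

section ProductSums

variable {ι B : Type*} [Fintype ι] [DecidableEq ι]

/-! Both inclusions pass through real-valued input distributions `N` whose output under every `chanZ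
p s` is `Q s`.

Achievability: draw the codewords i.i.d. from `N` and decode to any message whose likelihood ratio
exceeds `2 ^ (γ * n)` in some state. With `γ` below every mutual information, the true codeword
fails its test with probability O(1/n) by Chebyshev (`exists_not_passes_bound`). A wrong one passes
with probability at most `2 ^ (-(γ * n))` (`sum_passes_le`), and trying all states costs only a
constant factor. Averaged over a codeword, the interference is i.i.d. `Q s`, so its type
concentrates. All these quantities are nonnegative, so one codebook below the average of their sum
serves all states (`exists_code`).

Converse: the mean type of the codewords does not depend on the state. It satisfies a Fano
inequality in each state (`Code.le_mutualInfo`), and its output is the expected interference type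
(`Code.abs_output_sub_le`). A limit point, by compactness, is a single `N` with the prescribed
outputs and `R ≤ minInfo p N`.

From real distributions to types: the constraints on `N` are linear with rational coefficients. A
`ℚ`-linear map from `ℝ` to `ℚ` fixing 1, applied to each entry of `N`, preserves them, and it can be
chosen to move the entries very little (`exists_type_near`). Types are thus dense in a compact
polytope, and continuity of `minInfo` identifies the supremum over types with the maximum over the
polytope. -/

theorem prod_update_mul (W : ι → B → ℝ) (x : ι → B) (i : ι) (b : B) :
    (∏ j, W j (Function.update x i b j)) * W i (x i) = (∏ j, W j (x j)) * W i b := by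
  rw [← Finset.mul_prod_erase _ _ (Finset.mem_univ i),
    ← Finset.mul_prod_erase _ (fun j => W j (x j)) (Finset.mem_univ i)]
  have h : ∏ j ∈ Finset.univ.erase i, W j (Function.update x i b j) =
      ∏ j ∈ Finset.univ.erase i, W j (x j) :=
    Finset.prod_congr rfl fun j hj => by
      rw [Function.update_of_ne (Finset.ne_of_mem_erase hj)]
  rw [h, Function.update_self]
  ring

variable [Fintype B]

theorem sum_pi_prod (f : ι → B → ℝ) :
    ∑ x : ι → B, ∏ i, f i (x i) = ∏ i, ∑ b, f i b := by
  rw [Finset.prod_univ_sum, Fintype.piFinset_univ]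

/-- Resampling one coordinate does not change an expectation under a product distribution. -/
theorem sum_pi_resample (W : ι → B → ℝ) (hW : ∀ i, ∑ b, W i b = 1) (i : ι)
    (G : (ι → B) → ℝ) :
    ∑ x : ι → B, (∏ j, W j (x j)) * G x =
      ∑ x : ι → B, (∏ j, W j (x j)) * ∑ b, W i b * G (Function.update x i b) := by
  have h1 : ∑ x : ι → B, (∏ j, W j (x j)) * G x =
      ∑ q : (ι → B) × B, (∏ j, W j (q.1 j)) * W i q.2 * G q.1 := by
    rw [Fintype.sum_prod_type]
    refine Finset.sum_congr rfl fun x _ => ?_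
    simp only
    rw [← Finset.sum_mul, ← Finset.mul_sum, hW, mul_one]
  have h2 : ∑ x : ι → B, (∏ j, W j (x j)) * ∑ b, W i b * G (Function.update x i b) =
      ∑ q : (ι → B) × B, (∏ j, W j (q.1 j)) * W i q.2 * G (Function.update q.1 i q.2) := by
    rw [Fintype.sum_prod_type]
    refine Finset.sum_congr rfl fun x _ => ?_
    rw [Finset.mul_sum]
    exact Finset.sum_congr rfl fun b _ => by ring
  -- Exchanging coordinate `i` with the fresh symbol is an involution that preserves the weight, by
  -- `prod_update_mul`.
  let e : (ι → B) × B → (ι → B) × B := fun q => (Function.update q.1 i q.2, q.1 i)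
  have he : Function.Involutive e := fun q => by simp [e]
  rw [h1, h2, ← Equiv.sum_comp he.toPerm]
  refine Finset.sum_congr rfl fun q _ => ?_
  simp only [Function.Involutive.coe_toPerm, e]
  rw [prod_update_mul]

theorem sum_pi_coord (W : ι → B → ℝ) (hW : ∀ i, ∑ b, W i b = 1) (i : ι) (f : B → ℝ) :
    ∑ x : ι → B, (∏ j, W j (x j)) * f (x i) = ∑ b, W i b * f b := by
  rw [sum_pi_resample W hW i]
  simp only [Function.update_self]
  rw [← Finset.sum_mul, sum_pi_prod]
  simp [hW]

theorem sum_pi_prod_eq_one (W : ι → B → ℝ) (hW : ∀ i, ∑ b, W i b = 1) :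
    ∑ x : ι → B, ∏ j, W j (x j) = 1 := by
  rw [sum_pi_prod]; simp [hW]

/-- Independence kills the cross terms: resampling coordinate `k` replaces `g (x k)` by its mean 0.
-/
theorem sum_pi_second_moment (P : B → ℝ) (hP : ∑ b, P b = 1) (g : B → ℝ)
    (hg : ∑ b, P b * g b = 0) :
    ∑ x : ι → B, (∏ j, P (x j)) * (∑ i, g (x i)) ^ 2 =
      Fintype.card ι * ∑ b, P b * g b ^ 2 := by
  have hpair : ∀ i k : ι, ∑ x : ι → B, (∏ j, P (x j)) * (g (x i) * g (x k)) =
      if i = k then ∑ b, P b * g b ^ 2 else 0 := by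
    intro i k
    split_ifs with h
    · subst h
      rw [← sum_pi_coord (fun _ => P) (fun _ => hP) i]
      exact Finset.sum_congr rfl fun x _ => by ring
    · rw [sum_pi_resample (fun _ => P) (fun _ => hP) k]
      refine Finset.sum_eq_zero fun x _ => ?_
      have : ∑ b, P b * (g (Function.update x k b i) * g (Function.update x k b k)) =
          g (x i) * ∑ b, P b * g b := by
        rw [Finset.mul_sum]
        refine Finset.sum_congr rfl fun b _ => ?_
        rw [Function.update_of_ne h, Function.update_self]
        ring
      rw [this, hg]
      simp
  calc ∑ x : ι → B, (∏ j, P (x j)) * (∑ i, g (x i)) ^ 2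
      = ∑ i, ∑ k, ∑ x : ι → B, (∏ j, P (x j)) * (g (x i) * g (x k)) := by
        rw [Finset.sum_congr rfl fun i _ => Finset.sum_comm, Finset.sum_comm]
        refine Finset.sum_congr rfl fun x _ => ?_
        rw [sq, Finset.sum_mul_sum, Finset.mul_sum]
        exact Finset.sum_congr rfl fun i _ => Finset.mul_sum _ _ _
    _ = _ := by simp [hpair]

-- On the event, the centred sum is at most `-(card ι * (μ - γ))`, so its normalised square
-- dominates the indicator.
open Classical in
theorem chebyshev_lower (P : B → ℝ) (hP : P ∈ pmfs B) (f : B → ℝ) {γ : ℝ}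
    (hγ : γ < ∑ b, P b * f b) [Nonempty ι] :
    ∑ x : ι → B, (∏ j, P (x j)) *
        (if ∑ i, f (x i) ≤ Fintype.card ι * γ then 1 else 0) ≤
      (∑ b, P b * (f b - ∑ b, P b * f b) ^ 2) / ((∑ b, P b * f b) - γ) ^ 2 /
        Fintype.card ι := by
  set μ := ∑ b, P b * f b with hμ
  have hc : (0 : ℝ) < Fintype.card ι := by exact_mod_cast Fintype.card_pos
  have hd : 0 < μ - γ := sub_pos.2 hγ
  have h2 := sum_pi_second_moment (ι := ι) P hP.2 (fun b => f b - μ) (by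
    simp only [mul_sub, Finset.sum_sub_distrib]
    rw [← Finset.sum_mul, hP.2, ← hμ]; ring)
  have hle : ∑ x : ι → B, (∏ j, P (x j)) *
        (if ∑ i, f (x i) ≤ Fintype.card ι * γ then 1 else 0) ≤
      ∑ x : ι → B, (∏ j, P (x j)) *
        ((∑ i, (f (x i) - μ)) ^ 2 / (Fintype.card ι * (μ - γ)) ^ 2) := by
    refine Finset.sum_le_sum fun x _ => mul_le_mul_of_nonneg_left ?_
      (Finset.prod_nonneg fun i _ => hP.1 _)
    split_ifs with h
    · rw [le_div_iff₀ (by positivity), one_mul, Finset.sum_sub_distrib]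
      simp only [Finset.sum_const, Finset.card_univ, nsmul_eq_mul]
      rw [← neg_sq (∑ i, f (x i) - _)]
      exact pow_le_pow_left₀ (by positivity) (by linarith) 2
    · positivity
  refine hle.trans (le_of_eq ?_)
  simp only [← mul_div_assoc]
  rw [← Finset.sum_div, h2]
  field_simp

end ProductSums

/-! ### Types -/

section Types

variable {A : Type*} {n : ℕ}

open Classical in
theorem occ_eq_sum (x : Fin n → A) (a : A) :
    (occ x a : ℝ) = ∑ i, if x i = a then (1 : ℝ) else 0 := by
  simp [occ]

theorem sum_occ_mul [Fintype A] (x : Fin n → A) (f : A → ℝ) :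
    ∑ a, (occ x a : ℝ) * f a = ∑ i, f (x i) := by
  classical
  simp only [occ_eq_sum, Finset.sum_mul]
  rw [Finset.sum_comm]
  exact Finset.sum_congr rfl fun i _ => by simp

theorem seqType_mem_pmfs [Fintype A] (hn : 0 < n) (x : Fin n → A) : seqType x ∈ pmfs A := by
  refine ⟨fun a => by unfold seqType; positivity, ?_⟩
  have h := sum_occ_mul x (fun _ => 1)
  simp only [mul_one, Finset.sum_const, Finset.card_univ, Fintype.card_fin, nsmul_eq_mul] at h
  simp only [seqType]
  rw [← Finset.sum_div, h, div_self (by positivity)]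

theorem types_subset_pmfs [Fintype A] : types A ⊆ pmfs A := by
  rintro _ ⟨n, hn, x, rfl⟩
  exact seqType_mem_pmfs hn x

theorem pmf_le_one [Fintype A] {P : A → ℝ} (hP : P ∈ pmfs A) (a : A) : P a ≤ 1 :=
  hP.2 ▸ Finset.single_le_sum (fun a _ => hP.1 a) (Finset.mem_univ a)

/-- A rational-valued probability mass function is a type. -/
theorem mem_types_of_rational [Fintype A] (q : A → ℚ) (h : (fun a => (q a : ℝ)) ∈ pmfs A) :
    (fun a => (q a : ℝ)) ∈ types A := by
  classical
  have hq0 : ∀ a, 0 ≤ q a := fun a => Rat.cast_nonneg.1 (h.1 a)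
  have hq1 : ∑ a, q a = 1 := by
    have h2 : ∑ a, (q a : ℝ) = 1 := h.2
    exact_mod_cast h2
  set d : ℕ := ∏ a, (q a).den with hd
  have hdpos : 0 < d := Finset.prod_pos fun a _ => (q a).den_pos
  have hk : ∀ a, ∃ k : ℕ, (k : ℚ) = q a * d := by
    intro a
    obtain ⟨e, he⟩ : (q a).den ∣ d := Finset.dvd_prod_of_mem _ (Finset.mem_univ a)
    refine ⟨(q a).num.toNat * e, ?_⟩
    have h1 : (((q a).num.toNat : ℤ) : ℚ) = (q a).num := by
      rw [Int.toNat_of_nonneg (Rat.num_nonneg.2 (hq0 a))]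
    have h2 : q a * (q a).den = (q a).num := Rat.mul_den_eq_num _
    rw [he]
    push_cast at h1 ⊢
    rw [h1, ← h2]; ring
  choose k hk using hk
  have hsum : ∑ a, k a = d := by
    have : ((∑ a, k a : ℕ) : ℚ) = d := by
      push_cast
      simp only [hk]
      rw [← Finset.sum_mul, hq1, one_mul]
    exact_mod_cast this
  -- Over the common denominator `d` the numerators `k a` add up to `d`; the sequence lists each `a`
  -- exactly `k a` times.
  let e : Fin d ≃ Σ a, Fin (k a) := (Fintype.equivFinOfCardEq (by simp [hsum])).symm
  refine ⟨d, hdpos, fun i => (e i).1, ?_⟩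
  funext a
  have hocc : occ (fun i => (e i).1) a = k a := by
    have h1 : ((occ (fun i => (e i).1) a : ℕ) : ℝ) = (k a : ℝ) := by
      rw [occ_eq_sum, Equiv.sum_comp e (fun t : Σ a, Fin (k a) => if t.1 = a then (1 : ℝ) else 0),
        Fintype.sum_sigma]
      rw [Finset.sum_eq_single a (fun b _ hb => by simp [hb]) (by simp)]
      simp
    exact_mod_cast h1
  simp only [seqType, hocc]
  have h3 : (k a : ℝ) = q a * d := by exact_mod_cast hk a
  rw [h3]
  field_simp

theorem exists_rational_of_mem_types {P : A → ℝ} (h : P ∈ types A) :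
    ∃ q : A → ℚ, ∀ a, P a = q a := by
  obtain ⟨n, -, x, rfl⟩ := h
  exact ⟨fun a => (occ x a : ℚ) / n, fun a => by simp [seqType]⟩

/-- The type of an i.i.d. sequence is close to the underlying distribution in mean square. -/
theorem sum_pi_variational_sq_le [Fintype A] (P : A → ℝ) (hP : P ∈ pmfs A) (hn : 0 < n) :
    ∑ x : Fin n → A, (∏ i, P (x i)) * variational P (seqType x) ^ 2 ≤
      (Fintype.card A : ℝ) ^ 2 / n := by
  classical
  have hn' : (0 : ℝ) < n := by exact_mod_cast hn
  have hmean : ∀ c, ∑ a, P a * ((if a = c then (1 : ℝ) else 0) - P c) = 0 := by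
    intro c
    simp only [mul_sub, Finset.sum_sub_distrib, ← Finset.sum_mul, hP.2]
    simp
  have hvar : ∀ c, ∑ x : Fin n → A, (∏ i, P (x i)) * (P c - seqType x c) ^ 2 ≤ 1 / n := by
    intro c
    have h2 := sum_pi_second_moment (ι := Fin n) P hP.2
      (fun a => (if a = c then (1 : ℝ) else 0) - P c) (hmean c)
    have h3 : ∑ a, P a * ((if a = c then (1 : ℝ) else 0) - P c) ^ 2 ≤ 1 := by
      calc _ ≤ ∑ a, P a * 1 := by
            refine Finset.sum_le_sum fun a _ => mul_le_mul_of_nonneg_left ?_ (hP.1 a)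
            have h0 := hP.1 c
            have h1 := pmf_le_one hP c
            split_ifs <;> nlinarith
        _ = 1 := by simp [hP.2]
    have h4 : ∀ x : Fin n → A, (P c - seqType x c) ^ 2 =
        (∑ i, ((if x i = c then (1 : ℝ) else 0) - P c)) ^ 2 / n ^ 2 := by
      intro x
      rw [Finset.sum_sub_distrib, ← occ_eq_sum]
      simp only [seqType, Finset.sum_const, Finset.card_univ, Fintype.card_fin, nsmul_eq_mul]
      field_simp
      ring
    simp only [h4, ← mul_div_assoc]
    rw [← Finset.sum_div, h2, Fintype.card_fin, div_le_div_iff₀ (by positivity) hn']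
    nlinarith [mul_le_mul_of_nonneg_left h3 (sq_nonneg (n : ℝ))]
  calc _ ≤ ∑ x : Fin n → A, (∏ i, P (x i)) *
        (Fintype.card A * ∑ c, (P c - seqType x c) ^ 2) := by
        refine Finset.sum_le_sum fun x _ => mul_le_mul_of_nonneg_left ?_
          (Finset.prod_nonneg fun i _ => hP.1 _)
        -- Cauchy–Schwarz gives one factor `card A`; summing the variances over `c` gives the other.
        refine (sq_sum_le_card_mul_sum_sq (s := Finset.univ)).trans ?_
        simp
    _ = Fintype.card A * ∑ c, ∑ x : Fin n → A, (∏ i, P (x i)) * (P c - seqType x c) ^ 2 := by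
        rw [Finset.sum_comm, Finset.mul_sum]
        refine Finset.sum_congr rfl fun x _ => ?_
        rw [← Finset.mul_sum]; ring
    _ ≤ Fintype.card A * ∑ c : A, (1 / n : ℝ) := by
        gcongr with c; exact hvar c
    _ = _ := by simp; ring

end Types

/-! ### Mutual information -/

/-- All rows are probability mass functions. -/
def IsChannel {A B : Type*} [Fintype B] (J : A → B → ℝ) : Prop := ∀ a, J a ∈ pmfs B

section Info

variable {A B : Type*} [Fintype A] [Fintype B]

theorem output_nonneg {N : A → ℝ} (hN : ∀ a, 0 ≤ N a) {J : A → B → ℝ} (hJ : IsChannel J) (b : B) :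
    0 ≤ output N J b :=
  Finset.sum_nonneg fun a _ => mul_nonneg (hN a) ((hJ a).1 b)

theorem output_pos {N : A → ℝ} (hN : ∀ a, 0 ≤ N a) {J : A → B → ℝ} (hJ : IsChannel J)
    {a : A} {b : B} (ha : 0 < N a) (hb : 0 < J a b) : 0 < output N J b :=
  (mul_pos ha hb).trans_le (Finset.single_le_sum (f := fun a => N a * J a b)
    (fun a _ => mul_nonneg (hN a) ((hJ a).1 b)) (Finset.mem_univ a))

theorem output_mem_pmfs {N : A → ℝ} (hN : N ∈ pmfs A) {J : A → B → ℝ} (hJ : IsChannel J) :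
    output N J ∈ pmfs B := by
  refine ⟨output_nonneg hN.1 hJ, ?_⟩
  simp only [output]
  rw [Finset.sum_comm]
  simp [← Finset.mul_sum, (hJ _).2, hN.2]

theorem joint_mem_pmfs {N : A → ℝ} (hN : N ∈ pmfs A) {J : A → B → ℝ} (hJ : IsChannel J) :
    joint N J ∈ pmfs (A × B) := by
  refine ⟨fun q => mul_nonneg (hN.1 _) ((hJ _).1 _), ?_⟩
  rw [Fintype.sum_prod_type]
  simp [joint, ← Finset.mul_sum, (hJ _).2, hN.2]

theorem mutualInfo_joint (N : A → ℝ) {J : A → B → ℝ} (hJ : IsChannel J) :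
    mutualInfo (joint N J) =
      ∑ a, N a * ∑ b, J a b * Real.logb 2 (J a b / output N J b) := by
  refine Finset.sum_congr rfl fun a _ => ?_
  rw [Finset.mul_sum]
  refine Finset.sum_congr rfl fun b _ => ?_
  simp only [joint]
  rw [← Finset.mul_sum, (hJ a).2, mul_one]
  by_cases h : N a = 0
  · simp [h]
  · rw [mul_div_mul_left _ _ h, mul_assoc]
    rfl

/-- The form that shows continuity: the first term is linear in `N`, and the second is built from `t
* log t`, continuous also at 0. -/
theorem mutualInfo_joint_eq_sub {N : A → ℝ} (hN : ∀ a, 0 ≤ N a) {J : A → B → ℝ}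
    (hJ : IsChannel J) :
    mutualInfo (joint N J) = (∑ a, N a * ∑ b, J a b * Real.logb 2 (J a b)) -
      (∑ b, output N J b * Real.log (output N J b)) / Real.log 2 := by
  have h : ∀ b, output N J b * Real.log (output N J b) / Real.log 2 =
      ∑ a, N a * (J a b * Real.logb 2 (output N J b)) := by
    intro b
    rw [mul_div_assoc]
    conv_lhs => rw [output, Finset.sum_mul]
    exact Finset.sum_congr rfl fun a _ => by simp only [Real.logb, output]; ring
  rw [mutualInfo_joint N hJ, Finset.sum_div, Finset.sum_congr rfl fun b _ => h b,
    Finset.sum_comm (s := (Finset.univ : Finset B)), ← Finset.sum_sub_distrib]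
  refine Finset.sum_congr rfl fun a _ => ?_
  rw [Finset.mul_sum, Finset.mul_sum, ← Finset.sum_sub_distrib]
  refine Finset.sum_congr rfl fun b _ => ?_
  rcases (hN a).eq_or_lt with h0 | h0
  · simp [← h0]
  rcases ((hJ a).1 b).eq_or_lt with h1 | h1
  · simp [← h1]
  rw [Real.logb_div h1.ne' (output_pos hN hJ h0 h1).ne']
  ring

theorem continuous_output {B : Type*} (J : A → B → ℝ) : Continuous fun N : A → ℝ => output N J := by
  unfold output; fun_prop

theorem continuousOn_mutualInfo {J : A → B → ℝ} (hJ : IsChannel J) :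
    ContinuousOn (fun N : A → ℝ => mutualInfo (joint N J)) (pmfs A) := by
  refine ContinuousOn.congr (f := fun N : A → ℝ =>
    (∑ a, N a * ∑ b, J a b * Real.logb 2 (J a b)) -
      (∑ b, output N J b * Real.log (output N J b)) / Real.log 2) ?_
    fun N hN => mutualInfo_joint_eq_sub hN.1 hJ
  refine Continuous.continuousOn (Continuous.sub (by fun_prop) (Continuous.div_const ?_ _))
  refine continuous_finsetSum _ fun b _ => ?_
  exact Real.continuous_mul_log.comp ((continuous_apply b).comp (continuous_output J))

theorem isCompact_pmfs : IsCompact (pmfs A) := by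
  have : pmfs A = stdSimplex ℝ A := rfl
  rw [this]
  exact isCompact_stdSimplex ℝ A

end Info

/-! ### Density of rational solutions -/

/-- Finitely many real numbers can be approximated by the values of a `ℚ`-linear retraction
of `ℝ` onto `ℚ`. -/
theorem exists_linearMap_rat_near {ι : Type*} [Fintype ι] (v : ι → ℝ) {ε : ℝ} (hε : 0 < ε) :
    ∃ φ : ℝ →ₗ[ℚ] ℚ, φ 1 = 1 ∧ ∀ i, |(φ (v i) : ℝ) - v i| < ε := by
  classical
  -- Extend 1 to a Hamel basis, keep 1 fixed and send each other basis element to a nearby rational.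
  have hli : LinearIndepOn ℚ id ({1} : Set ℝ) := LinearIndepOn.singleton (by simp)
  let b := Module.Basis.extend hli
  have h1mem : (1 : ℝ) ∈ hli.extend (Set.subset_univ _) :=
    hli.subset_extend (Set.subset_univ _) (Set.mem_singleton _)
  -- `C` bounds the coefficient sum of each `v i`, so moving basis elements by less than `δ` moves
  -- `v i` by at most `C * δ < ε`.
  set C : ℝ := ∑ i, ∑ e ∈ (b.repr (v i)).support, |((b.repr (v i) e : ℚ) : ℝ)| with hC
  have hC0 : 0 ≤ C := Finset.sum_nonneg fun i _ => Finset.sum_nonneg fun e _ => abs_nonneg _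
  set δ : ℝ := ε / (C + 1) with hδ
  have hδ0 : 0 < δ := by positivity
  have hq : ∀ x : ℝ, ∃ q : ℚ, |(q : ℝ) - x| < δ := fun x => by
    obtain ⟨q, h1, h2⟩ := exists_rat_btwn (show x < x + δ by linarith)
    exact ⟨q, by rw [abs_lt]; constructor <;> linarith⟩
  choose r hr using hq
  let f : hli.extend (Set.subset_univ _) → ℚ := fun e => if (e : ℝ) = 1 then 1 else r e
  have hf : ∀ e, |(f e : ℝ) - (e : ℝ)| < δ := by
    intro e
    simp only [f]
    split_ifs with h
    · rw [h]; simpa using hδ0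
    · exact hr _
  refine ⟨b.constr ℚ f, ?_, fun i => ?_⟩
  · have hb : b ⟨1, h1mem⟩ = 1 := Module.Basis.extend_apply_self hli ⟨1, h1mem⟩
    have hφ := b.constr_basis ℚ f ⟨1, h1mem⟩
    rw [hb] at hφ
    rw [hφ]
    simp [f]
  · have hv : v i = ∑ e ∈ (b.repr (v i)).support, ((b.repr (v i) e : ℚ) : ℝ) * (e : ℝ) := by
      conv_lhs => rw [← b.linearCombination_repr (v i), Finsupp.linearCombination_apply,
        Finsupp.sum]
      refine Finset.sum_congr rfl fun e _ => ?_
      rw [Rat.smul_def]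
      congr 1
      exact Module.Basis.extend_apply_self hli e
    have hφ : ((b.constr ℚ f (v i) : ℚ) : ℝ) =
        ∑ e ∈ (b.repr (v i)).support, ((b.repr (v i) e : ℚ) : ℝ) * (f e : ℝ) := by
      rw [Module.Basis.constr_apply, Finsupp.sum]
      push_cast [smul_eq_mul]
      rfl
    rw [hφ]
    nth_rw 3 [hv]
    rw [← Finset.sum_sub_distrib]
    calc _ ≤ ∑ e ∈ (b.repr (v i)).support, |((b.repr (v i) e : ℚ) : ℝ)| * δ := by
          refine (Finset.abs_sum_le_sum_abs _ _).trans (Finset.sum_le_sum fun e _ => ?_)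
          rw [← mul_sub, abs_mul]
          exact mul_le_mul_of_nonneg_left (hf e).le (abs_nonneg _)
      _ ≤ C * δ := by
          rw [← Finset.sum_mul]
          refine mul_le_mul_of_nonneg_right ?_ hδ0.le
          exact Finset.single_le_sum (f := fun i => ∑ e ∈ (b.repr (v i)).support,
            |((b.repr (v i) e : ℚ) : ℝ)|)
            (fun i _ => Finset.sum_nonneg fun e _ => abs_nonneg _) (Finset.mem_univ i)
      _ < ε := by
          rw [hδ, ← mul_div_assoc, div_lt_iff₀ (by positivity)]
          nlinarith

/-- Types are dense in the set of input distributions with prescribed rational outputs. -/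
theorem exists_type_near {A B S : Type*} [Fintype A] {N : A → ℝ} (hN : N ∈ pmfs A)
    {K : S → A → B → ℝ} {Q : S → B → ℝ} (hK : ∀ s a b, ∃ q : ℚ, K s a b = q)
    (hQ : ∀ s b, ∃ q : ℚ, Q s b = q) (hNQ : ∀ s, output N (K s) = Q s) {ε : ℝ} (hε : 0 < ε) :
    ∃ N' ∈ types A, (∀ s, output N' (K s) = Q s) ∧ ∀ a, |N' a - N a| < ε := by
  classical
  choose k hk using hK
  choose q hq using hQ
  -- An error below the least positive mass keeps positive entries nonnegative; zero entries stay
  -- zero by linearity of `φ`.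
  obtain ⟨η, hη0, hηε, hη⟩ : ∃ η : ℝ, 0 < η ∧ η ≤ ε ∧ ∀ a, 0 < N a → η ≤ N a := by
    let t : Finset ℝ := insert ε ((Finset.univ.filter fun a => 0 < N a).image N)
    have ht : t.Nonempty := Finset.insert_nonempty _ _
    refine ⟨t.min' ht, ?_, Finset.min'_le _ _ (Finset.mem_insert_self _ _), fun a ha =>
      Finset.min'_le _ _ ?_⟩
    · rw [Finset.lt_min'_iff]
      intro y hy
      simp only [t, Finset.mem_insert, Finset.mem_image, Finset.mem_filter] at hy
      rcases hy with rfl | ⟨a, ha, rfl⟩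
      · exact hε
      · exact ha.2
    · simp only [t, Finset.mem_insert, Finset.mem_image, Finset.mem_filter]
      exact Or.inr ⟨a, ⟨Finset.mem_univ a, ha⟩, rfl⟩
  obtain ⟨φ, hφ1, hφ⟩ := exists_linearMap_rat_near N hη0
  have hφrat : ∀ r : ℚ, φ (r : ℝ) = r := fun r => by
    have := φ.map_smul r 1
    rwa [hφ1, Rat.smul_def, mul_one, smul_eq_mul, mul_one] at this
  refine ⟨fun a => (φ (N a) : ℝ), mem_types_of_rational (fun a => φ (N a)) ⟨fun a => ?_, ?_⟩,
    fun s => ?_, fun a => (hφ a).trans_le hηε⟩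
  · rcases (hN.1 a).eq_or_lt with h | h
    · simp [← h]
    · have h1 := (abs_lt.1 (hφ a)).1
      have h2 := hη a h
      linarith
  · have : ∑ a, φ (N a) = 1 := by rw [← map_sum, hN.2, hφ1]
    have h2 : ((∑ a, φ (N a) : ℚ) : ℝ) = 1 := by rw [this]; simp
    rwa [Rat.cast_sum] at h2
  · funext b
    have h1 : ∑ a, φ (N a) * k s a b = q s b := by
      rw [← hφrat (q s b), ← hq, ← hNQ s, output, map_sum]
      refine Finset.sum_congr rfl fun a _ => ?_
      rw [hk, mul_comm (N a), ← Rat.smul_def, φ.map_smul, smul_eq_mul, mul_comm]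
    simp only [output, hk, hq]
    exact_mod_cast h1

/-! ### The compound channel -/

section Channel

variable {X Y Z S : Type*} [Fintype Y]

theorem isChannel_of_mem_condTypes {A B : Type*} [Fintype B] {J : A → B → ℝ}
    (h : J ∈ condTypes A B) : IsChannel J := by
  classical
  obtain ⟨n, -, x, y, hx, hJ⟩ := h
  intro a
  refine ⟨fun b => by rw [hJ]; positivity, ?_⟩
  have h0 : (occ x a : ℝ) ≠ 0 := by exact_mod_cast (hx a).ne'
  simp only [hJ]
  rw [← Finset.sum_div, div_eq_one_iff_eq h0]
  simp only [occ_eq_sum]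
  rw [Finset.sum_comm]
  refine Finset.sum_congr rfl fun i _ => ?_
  by_cases hi : x i = a <;> simp [hi]

theorem rational_of_mem_condTypes {A B : Type*} {J : A → B → ℝ}
    (h : J ∈ condTypes A B) (a : A) (b : B) : ∃ q : ℚ, J a b = q := by
  obtain ⟨n, -, x, y, -, hJ⟩ := h
  exact ⟨occ (fun i => (x i, y i)) (a, b) / occ x a, by rw [hJ]; push_cast; rfl⟩

variable {p : X × S → Y × Z → ℝ}

theorem commonPreimage_near [Fintype X] (hp : p ∈ condTypes (X × S) (Y × Z)) {Q : S → Z → ℝ}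
    (hQ : ∀ s, Q s ∈ types Z) {N : X → ℝ} (hN : N ∈ pmfs X)
    (hNQ : ∀ s, output N (chanZ p s) = Q s) :
    N ∈ closure (commonPreimage p Q) := by
  rw [Metric.mem_closure_iff]
  intro ε hε
  have hK : ∀ s a c, ∃ q : ℚ, chanZ p s a c = q := by
    intro s a c
    choose r hr using rational_of_mem_condTypes hp
    exact ⟨∑ b, r (a, s) (b, c), by simp [chanZ, hr]⟩
  have hQ' : ∀ s c, ∃ q : ℚ, Q s c = q := fun s c => by
    obtain ⟨q, hq⟩ := exists_rational_of_mem_types (hQ s)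
    exact ⟨q c, hq c⟩
  obtain ⟨N', hN', hout, hnear⟩ := exists_type_near hN hK hQ' hNQ hε
  refine ⟨N', Set.mem_iInter.2 fun s => ⟨hN', hout s⟩, ?_⟩
  rw [dist_comm, dist_pi_lt_iff hε]
  exact hnear

theorem commonPreimage_subset [Fintype X] [Nonempty S] (Q : S → Z → ℝ) :
    commonPreimage p Q ⊆ {N | N ∈ pmfs X ∧ ∀ s, output N (chanZ p s) = Q s} := fun _ hN =>
  ⟨types_subset_pmfs (Set.mem_iInter.1 hN (Classical.arbitrary S)).1,
    fun s => (Set.mem_iInter.1 hN s).2⟩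

variable [Fintype Z]

theorem isChannel_chanY (hp : IsChannel p) (s : S) : IsChannel (chanY p s) := fun a =>
  ⟨fun b => Finset.sum_nonneg fun c _ => (hp _).1 _, by
    simp only [chanY]; rw [← Fintype.sum_prod_type', (hp _).2]⟩

theorem isChannel_chanZ (hp : IsChannel p) (s : S) : IsChannel (chanZ p s) := fun a =>
  ⟨fun c => Finset.sum_nonneg fun b _ => (hp _).1 _, by
    simp only [chanZ]; rw [← Fintype.sum_prod_type_right', (hp _).2]⟩

theorem minInfo_le [Fintype X] [Finite S] (p : X × S → Y × Z → ℝ) (N : X → ℝ) (s : S) :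
    minInfo p N ≤ mutualInfo (joint N (chanY p s)) :=
  ciInf_le (Set.finite_range _).bddBelow s

variable [Fintype X] [Fintype S] [Nonempty S]

theorem continuousOn_minInfo (hp : IsChannel p) : ContinuousOn (minInfo p) (pmfs X) := by
  have h : minInfo p = fun N => Finset.univ.inf' Finset.univ_nonempty
      fun s => mutualInfo (joint N (chanY p s)) := by
    funext N; rw [Finset.inf'_univ_eq_ciInf]; rfl
  rw [h]
  exact ContinuousOn.finset_inf'_apply _ fun s _ => continuousOn_mutualInfo (isChannel_chanY hp s)

/-- The maximum exists by compactness. An upper bound over the types extends to their closure by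
continuity, and that closure contains the maximiser. -/
theorem exists_isLUB_isGreatest_minInfo (hp : p ∈ condTypes (X × S) (Y × Z)) {Q : S → Z → ℝ}
    (hQ : ∀ s, Q s ∈ types Z) (hne : (commonPreimage p Q).Nonempty) :
    ∃ v : ℝ, IsLUB (minInfo p '' commonPreimage p Q) v ∧
      IsGreatest (minInfo p '' {N | N ∈ pmfs X ∧ ∀ s, output N (chanZ p s) = Q s}) v := by
  have hch := isChannel_of_mem_condTypes hp
  set T : Set (X → ℝ) := {N | N ∈ pmfs X ∧ ∀ s, output N (chanZ p s) = Q s} with hT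
  have hTc : IsCompact T := by
    have : T = pmfs X ∩ ⋂ s, {N | output N (chanZ p s) = Q s} := by ext; simp [T]
    rw [this]
    exact isCompact_pmfs.inter_right
      (isClosed_iInter fun s => isClosed_eq (continuous_output _) continuous_const)
  have hcont := continuousOn_minInfo hch
  obtain ⟨N, hN, hmax⟩ := hTc.exists_isMaxOn (hne.mono (commonPreimage_subset Q))
    (hcont.mono fun N hN => hN.1)
  refine ⟨minInfo p N, ⟨?_, fun u hu => ?_⟩, ⟨⟨N, hN, rfl⟩, ?_⟩⟩
  · rintro _ ⟨N', hN', rfl⟩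
    exact hmax (commonPreimage_subset Q hN')
  · have hcl := commonPreimage_near hp hQ hN.1 hN.2
    have hsub : commonPreimage p Q ⊆ pmfs X := fun N hN => (commonPreimage_subset Q hN).1
    have hmem := ((hcont N hN.1).mono hsub).mem_closure_image hcl
    exact closure_minimal (fun y hy => hu hy) isClosed_Iic hmem
  · rintro _ ⟨N', hN', rfl⟩
    exact hmax hN'

end Channel

/-! ### Marginals of the block channel -/

section Marginals

variable {X Y Z S : Type*} [Fintype Y] [Fintype Z] {M n : ℕ}

open Classical in
theorem prob_receiver (p : X × S → Y × Z → ℝ) (s : S) (c : Code X Y M n)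
    (D : Fin M → (Fin n → Y) → Prop) :
    prob p s c (fun m y _ => D m y) =
      (∑ m, ∑ y : Fin n → Y, if D m y then ∏ i, chanY p s (c.enc m i) (y i) else 0) / M := by
  unfold prob
  congr 1
  refine Finset.sum_congr rfl fun m _ => Finset.sum_congr rfl fun y _ => ?_
  split_ifs
  · exact sum_pi_prod fun i z => p (c.enc m i, s) (y i, z)
  · simp

open Classical in
theorem prob_observer (p : X × S → Y × Z → ℝ) (s : S) (c : Code X Y M n)
    (D : (Fin n → Z) → Prop) :
    prob p s c (fun _ _ z => D z) =
      (∑ m, ∑ z : Fin n → Z, if D z then ∏ i, chanZ p s (c.enc m i) (z i) else 0) / M := by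
  unfold prob
  congr 1
  refine Finset.sum_congr rfl fun m _ => ?_
  rw [Finset.sum_comm]
  refine Finset.sum_congr rfl fun z _ => ?_
  split_ifs
  · exact sum_pi_prod fun i y => p (c.enc m i, s) (y, z i)
  · simp

theorem prob_nonneg {p : X × S → Y × Z → ℝ} (hp : IsChannel p) (s : S) (c : Code X Y M n)
    (E : Fin M → (Fin n → Y) → (Fin n → Z) → Prop) : 0 ≤ prob p s c E := by
  refine div_nonneg (Finset.sum_nonneg fun m _ => Finset.sum_nonneg fun y _ =>
    Finset.sum_nonneg fun z _ => ?_) (Nat.cast_nonneg _)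
  split_ifs
  · exact Finset.prod_nonneg fun i _ => (hp _).1 _
  · exact le_rfl

/-- Markov's inequality for the squared deviation, which random coding can control on average. -/
theorem prob_variational_le {p : X × S → Y × Z → ℝ} (hp : IsChannel p) (s : S)
    (c : Code X Y M n) (Q : Z → ℝ) {ε : ℝ} (hε : 0 < ε) :
    prob p s c (fun _ _ z => ε ≤ variational Q (seqType z)) ≤
      (∑ m, ∑ z : Fin n → Z, (∏ i, chanZ p s (c.enc m i) (z i)) *
        variational Q (seqType z) ^ 2) / M / ε ^ 2 := by
  rw [prob_observer, div_right_comm]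
  refine div_le_div_of_nonneg_right ?_ (Nat.cast_nonneg M)
  rw [Finset.sum_div]
  refine Finset.sum_le_sum fun m _ => ?_
  rw [Finset.sum_div]
  refine Finset.sum_le_sum fun z _ => ?_
  have h0 : 0 ≤ ∏ i, chanZ p s (c.enc m i) (z i) :=
    Finset.prod_nonneg fun i _ => (isChannel_chanZ hp s _).1 _
  split_ifs with h
  · rw [le_div_iff₀ (by positivity)]
    exact mul_le_mul_of_nonneg_left (pow_le_pow_left₀ hε.le h 2) h0
  · positivity

end Marginals

/-! ### Random coding -/

section RandomCoding

variable {A B : Type*} [Fintype A] [Fintype B] {n : ℕ}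

theorem sum_pi_joint (N : A → ℝ) (J : A → B → ℝ) (H : (Fin n → A) → (Fin n → B) → ℝ) :
    ∑ x : Fin n → A, (∏ i, N (x i)) * ∑ y : Fin n → B, (∏ i, J (x i) (y i)) * H x y =
      ∑ w : Fin n → A × B, (∏ i, joint N J (w i)) * H (fun i => (w i).1) (fun i => (w i).2) := by
  rw [← Equiv.sum_comp (Equiv.arrowProdEquivProdArrow (Fin n) (fun _ => A) (fun _ => B)).symm,
    Fintype.sum_prod_type]
  refine Finset.sum_congr rfl fun x _ => ?_
  rw [Finset.mul_sum]
  refine Finset.sum_congr rfl fun y _ => ?_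
  simp only [Equiv.arrowProdEquivProdArrow, Equiv.coe_fn_symm_mk, joint, Finset.prod_mul_distrib]
  ring

theorem sum_pi_input {B : Type*} (N : A → ℝ) (J : A → B → ℝ) (y : Fin n → B) :
    ∑ x : Fin n → A, (∏ i, N (x i)) * ∏ i, J (x i) (y i) = ∏ i, output N J (y i) := by
  simp only [← Finset.prod_mul_distrib]
  exact sum_pi_prod fun i a => N a * J a (y i)

theorem sum_pi_output (N : A → ℝ) (J : A → B → ℝ) (f : (Fin n → B) → ℝ) :
    ∑ x : Fin n → A, (∏ i, N (x i)) * ∑ y : Fin n → B, (∏ i, J (x i) (y i)) * f y =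
      ∑ y : Fin n → B, (∏ i, output N J (y i)) * f y := by
  simp only [Finset.mul_sum]
  rw [Finset.sum_comm]
  refine Finset.sum_congr rfl fun y _ => ?_
  rw [← sum_pi_input, Finset.sum_mul]
  exact Finset.sum_congr rfl fun x _ => by ring

/-- The likelihood of `y` given `x` exceeds its unconditional likelihood by the factor
`2 ^ (γ * n)`. -/
def Passes (N : A → ℝ) (J : A → B → ℝ) (γ : ℝ) (x : Fin n → A) (y : Fin n → B) : Prop :=
  (2 : ℝ) ^ (γ * n) * ∏ i, output N J (y i) < ∏ i, J (x i) (y i)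

-- The per-letter log-likelihood ratio `f` has mean equal to the mutual information, and failing the
-- test puts its sum at or below `γ * n`.
open Classical in
theorem exists_not_passes_bound {N : A → ℝ} (hN : N ∈ pmfs A) {J : A → B → ℝ}
    (hJ : IsChannel J) {γ : ℝ} (hγ : γ < mutualInfo (joint N J)) :
    ∃ α : ℝ, ∀ n : ℕ, 0 < n →
      ∑ x : Fin n → A, (∏ i, N (x i)) * ∑ y : Fin n → B, (∏ i, J (x i) (y i)) *
        (if Passes N J γ x y then 0 else 1) ≤ α / n := by
  let f : A × B → ℝ := fun w => Real.logb 2 (J w.1 w.2 / output N J w.2)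
  have hI : ∑ w, joint N J w * f w = mutualInfo (joint N J) := by
    rw [mutualInfo_joint N hJ, Fintype.sum_prod_type]
    refine Finset.sum_congr rfl fun a _ => ?_
    rw [Finset.mul_sum]
    exact Finset.sum_congr rfl fun b _ => by simp only [joint, f]; ring
  rw [← hI] at hγ
  have hP := joint_mem_pmfs hN hJ
  refine ⟨(∑ w, joint N J w * (f w - ∑ w, joint N J w * f w) ^ 2) /
    ((∑ w, joint N J w * f w) - γ) ^ 2, fun n hn => ?_⟩
  have : Nonempty (Fin n) := ⟨⟨0, hn⟩⟩
  have hc := chebyshev_lower (ι := Fin n) (joint N J) hP f hγ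
  rw [Fintype.card_fin] at hc
  refine le_trans ?_ hc
  rw [sum_pi_joint N J fun x y => if Passes N J γ x y then 0 else 1]
  refine Finset.sum_le_sum fun w _ => ?_
  have h0 : ∀ i, 0 ≤ joint N J (w i) := fun i => hP.1 _
  -- Pairs of weight zero contribute nothing; on the others all logarithms have positive arguments.
  by_cases hz : ∏ i, joint N J (w i) = 0
  · simp [hz]
  refine mul_le_mul_of_nonneg_left ?_ (Finset.prod_nonneg fun i _ => h0 i)
  have hpos : ∀ i, 0 < N (w i).1 ∧ 0 < J (w i).1 (w i).2 := fun i => by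
    have h1 : joint N J (w i) ≠ 0 := Finset.prod_ne_zero_iff.1 hz i (Finset.mem_univ i)
    exact ⟨(hN.1 _).lt_of_ne' (left_ne_zero_of_mul h1),
      ((hJ _).1 _).lt_of_ne' (right_ne_zero_of_mul h1)⟩
  have hq : ∀ i, 0 < output N J (w i).2 := fun i => output_pos hN.1 hJ (hpos i).1 (hpos i).2
  split_ifs with h1 h2 h2
  · exact zero_le_one
  · exact le_rfl
  · exact le_rfl
  · refine absurd ?_ h2
    rw [Passes, not_lt] at h1
    have hJp : 0 < ∏ i, J (w i).1 (w i).2 := Finset.prod_pos fun i _ => (hpos i).2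
    have hqp : 0 < ∏ i, output N J (w i).2 := Finset.prod_pos fun i _ => hq i
    have h3 := Real.logb_le_logb_of_le (b := 2) (by norm_num) hJp h1
    rw [Real.logb_mul (by positivity) hqp.ne', Real.logb_rpow (by norm_num) (by norm_num),
      Real.logb_prod _ _ fun i _ => (hpos i).2.ne',
      Real.logb_prod _ _ fun i _ => (hq i).ne'] at h3
    have h4 : ∑ i, f (w i) =
        ∑ i, Real.logb 2 (J (w i).1 (w i).2) - ∑ i, Real.logb 2 (output N J (w i).2) := by
      rw [← Finset.sum_sub_distrib]
      exact Finset.sum_congr rfl fun i _ => Real.logb_div (hpos i).2.ne' (hq i).ne'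
    rw [h4]
    linarith

-- Change of measure: for a passing `x`, the factor 1 is below `2 ^ (-(γ * n))` times the likelihood
-- ratio, whose average over `x` is 1.
open Classical in
theorem sum_passes_le {N : A → ℝ} (hN : N ∈ pmfs A) {J : A → B → ℝ}
    (hJ : IsChannel J) (γ : ℝ) (y : Fin n → B) :
    ∑ x : Fin n → A, (∏ i, N (x i)) * (if Passes N J γ x y then 1 else 0) ≤
      (2 : ℝ) ^ (-(γ * n)) := by
  have hN0 : ∀ x : Fin n → A, 0 ≤ ∏ i, N (x i) := fun x =>
    Finset.prod_nonneg fun i _ => hN.1 _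
  have hJ0 : ∀ x : Fin n → A, 0 ≤ ∏ i, J (x i) (y i) := fun x =>
    Finset.prod_nonneg fun i _ => (hJ _).1 _
  have hΓ : (0 : ℝ) < 2 ^ (γ * n) := by positivity
  have hsum := sum_pi_input N J y
  have hq0 : 0 ≤ ∏ i, output N J (y i) :=
    Finset.prod_nonneg fun i _ => output_nonneg hN.1 hJ _
  rw [Real.rpow_neg (by norm_num)]
  rcases hq0.eq_or_lt with hq | hq
  -- If `y` has output probability 0, every `x` of positive weight has likelihood 0 and fails,
  -- because the test is strict.
  · rw [← hq, Finset.sum_eq_zero_iff_of_nonneg fun x _ => mul_nonneg (hN0 x) (hJ0 x)] at hsum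
    rw [Finset.sum_eq_zero]
    · positivity
    intro x hx
    split_ifs with h
    · rw [Passes, ← hq, mul_zero] at h
      rcases mul_eq_zero.1 (hsum x hx) with h1 | h1
      · rw [h1, zero_mul]
      · exact absurd h1 h.ne'
    · exact mul_zero _
  · rw [← one_div, le_div_iff₀ hΓ, ← mul_le_mul_iff_left₀ hq, one_mul]
    conv_rhs => rw [← hsum]
    rw [mul_assoc, Finset.sum_mul]
    refine Finset.sum_le_sum fun x _ => ?_
    rw [mul_assoc]
    refine mul_le_mul_of_nonneg_left ?_ (hN0 x)
    split_ifs with h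
    · rw [one_mul]; exact h.le
    · rw [zero_mul]; exact hJ0 x

theorem exists_le_of_average_le {C : Type*} [Fintype C] [Nonempty C] {w F : C → ℝ}
    (hw : ∀ c, 0 ≤ w c) (hw1 : ∑ c, w c = 1) {b : ℝ} (h : ∑ c, w c * F c ≤ b) :
    ∃ c, F c ≤ b := by
  obtain ⟨c, hc⟩ := Finite.exists_min F
  refine ⟨c, le_trans ?_ h⟩
  calc F c = ∑ c', w c' * F c := by rw [← Finset.sum_mul, hw1, one_mul]
    _ ≤ _ := Finset.sum_le_sum fun c' _ => mul_le_mul_of_nonneg_left (hc c') (hw c')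

end RandomCoding

/-! ### Threshold decoding and a codebook good in all states. -/

section Achievability

variable {X Y Z S : Type*} [Fintype X] [Fintype Z] [Fintype S]

open Classical in
/-- The decoder that picks a message whose codeword passes the threshold test for some state. -/
def thresholdCode {M n : ℕ} [NeZero M] (p : X × S → Y × Z → ℝ) (N : X → ℝ) (γ : ℝ)
    (e : Fin M → Fin n → X) : Code X Y M n where
  enc := e
  dec y := if h : ∃ m, ∃ s, Passes N (chanY p s) γ (e m) y then h.choose else 0

-- If the true codeword passes in the true state but decoding is wrong, the chosen message is a
-- competitor that passes in some state.
open Classical in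
theorem thresholdCode_error_le {M n : ℕ} [NeZero M] (p : X × S → Y × Z → ℝ) (N : X → ℝ) (γ : ℝ)
    (e : Fin M → Fin n → X) (s : S) (m : Fin M) (y : Fin n → Y) :
    (if (thresholdCode p N γ e).dec y ≠ m then (1 : ℝ) else 0) ≤
      (if Passes N (chanY p s) γ (e m) y then 0 else 1) +
      ∑ m' ∈ Finset.univ.erase m, ∑ t, if Passes N (chanY p t) γ (e m') y then 1 else 0 := by
  have hnn : ∀ m' t, (0 : ℝ) ≤ if Passes N (chanY p t) γ (e m') y then 1 else 0 := fun m' t => by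
    split_ifs <;> norm_num
  have hs : (0 : ℝ) ≤ ∑ m' ∈ Finset.univ.erase m, ∑ t,
      if Passes N (chanY p t) γ (e m') y then 1 else 0 :=
    Finset.sum_nonneg fun m' _ => Finset.sum_nonneg fun t _ => hnn m' t
  by_cases hp : Passes N (chanY p s) γ (e m) y
  · by_cases hd : (thresholdCode p N γ e).dec y = m
    · simpa [hd, hp] using hs
    · have hex : ∃ m, ∃ s, Passes N (chanY p s) γ (e m) y := ⟨m, s, hp⟩
      have hdec : (thresholdCode p N γ e).dec y = hex.choose := dif_pos hex
      rw [hdec] at hd ⊢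
      obtain ⟨t, ht⟩ := hex.choose_spec
      rw [if_pos hd, if_pos hp, zero_add]
      calc (1 : ℝ) = if Passes N (chanY p t) γ (e hex.choose) y then 1 else 0 := by rw [if_pos ht]
        _ ≤ ∑ t, if Passes N (chanY p t) γ (e hex.choose) y then 1 else 0 :=
            Finset.single_le_sum (f := fun t =>
              if Passes N (chanY p t) γ (e hex.choose) y then (1 : ℝ) else 0)
              (fun t _ => hnn _ t) (Finset.mem_univ t)
        _ ≤ _ := Finset.single_le_sum (f := fun m' => ∑ t,
              if Passes N (chanY p t) γ (e m') y then (1 : ℝ) else 0)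
              (fun m' _ => Finset.sum_nonneg fun t _ => hnn m' t)
              (Finset.mem_erase.2 ⟨hd, Finset.mem_univ _⟩)
  · rw [if_neg hp]
    split_ifs <;> linarith

variable [Fintype Y]

open Classical in
/-- Random coding: some code has small error probability and small mean square deviation of the
interference type in all states simultaneously. -/
theorem exists_code {p : X × S → Y × Z → ℝ} (hp : IsChannel p) {N : X → ℝ} (hN : N ∈ pmfs X)
    {γ : ℝ} (hγ : ∀ s, γ < mutualInfo (joint N (chanY p s))) :
    ∃ α : ℝ, ∀ M n : ℕ, 0 < M → 0 < n → ∃ c : Code X Y M n, ∀ s,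
      prob p s c (fun m y _ => c.dec y ≠ m) ≤
          α / n + Fintype.card S ^ 2 * (((M : ℝ) - 1) * 2 ^ (-(γ * n))) ∧
      (∑ m, ∑ z : Fin n → Z, (∏ i, chanZ p s (c.enc m i) (z i)) *
        variational (output N (chanZ p s)) (seqType z) ^ 2) / M ≤
          α / n + Fintype.card S ^ 2 * (((M : ℝ) - 1) * 2 ^ (-(γ * n))) := by
  choose α hα using fun s => exists_not_passes_bound hN (isChannel_chanY hp s) (hγ s)
  refine ⟨∑ s, (α s + (Fintype.card Z : ℝ) ^ 2), fun M n hM hn => ?_⟩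
  have : NeZero M := ⟨hM.ne'⟩
  have hM' : (0 : ℝ) < M := by exact_mod_cast hM
  have hX : Nonempty X := by
    by_contra h
    rw [not_nonempty_iff] at h
    simpa using hN.2
  let w : (Fin n → X) → ℝ := fun x => ∏ i, N (x i)
  have hw0 : ∀ x, 0 ≤ w x := fun x => Finset.prod_nonneg fun i _ => hN.1 _
  have hw1 : ∑ x, w x = 1 := sum_pi_prod_eq_one (fun _ => N) fun _ => hN.2
  let fail : S → (Fin n → X) → ℝ := fun s x => ∑ y : Fin n → Y,
    (∏ i, chanY p s (x i) (y i)) * (if Passes N (chanY p s) γ x y then 0 else 1)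
  let confuse : S → S → (Fin n → X) → (Fin n → X) → ℝ := fun s t x x' => ∑ y : Fin n → Y,
    (∏ i, chanY p s (x i) (y i)) * (if Passes N (chanY p t) γ x' y then 1 else 0)
  let dev : S → (Fin n → X) → ℝ := fun s x => ∑ z : Fin n → Z,
    (∏ i, chanZ p s (x i) (z i)) * variational (output N (chanZ p s)) (seqType z) ^ 2
  have hY0 : ∀ s (x : Fin n → X) (y : Fin n → Y), 0 ≤ ∏ i, chanY p s (x i) (y i) :=
    fun s x y => Finset.prod_nonneg fun i _ => (isChannel_chanY hp s _).1 _
  have hZ0 : ∀ s (x : Fin n → X) (z : Fin n → Z), 0 ≤ ∏ i, chanZ p s (x i) (z i) :=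
    fun s x y => Finset.prod_nonneg fun i _ => (isChannel_chanZ hp s _).1 _
  have hfail0 : ∀ s x, 0 ≤ fail s x := fun s x => Finset.sum_nonneg fun y _ =>
    mul_nonneg (hY0 s x y) (by split_ifs <;> norm_num)
  have hconf0 : ∀ s t x x', 0 ≤ confuse s t x x' := fun s t x x' => Finset.sum_nonneg fun y _ =>
    mul_nonneg (hY0 s x y) (by split_ifs <;> norm_num)
  have hdev0 : ∀ s x, 0 ≤ dev s x := fun s x => Finset.sum_nonneg fun z _ =>
    mul_nonneg (hZ0 s x z) (sq_nonneg _)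
  have Efail : ∀ s m, ∑ e : Fin M → Fin n → X, (∏ m, w (e m)) * fail s (e m) ≤ α s / n := by
    intro s m
    rw [sum_pi_coord (fun _ => w) (fun _ => hw1) m (fail s)]
    exact hα s n hn
  have Edev : ∀ s m, ∑ e : Fin M → Fin n → X, (∏ m, w (e m)) * dev s (e m) ≤
      (Fintype.card Z : ℝ) ^ 2 / n := by
    intro s m
    rw [sum_pi_coord (fun _ => w) (fun _ => hw1) m (dev s)]
    simp only [w, dev]
    rw [sum_pi_output N (chanZ p s)]
    exact sum_pi_variational_sq_le _ (output_mem_pmfs hN (isChannel_chanZ hp s)) hn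
  have Econf : ∀ s t m, ∀ m' ∈ Finset.univ.erase m, ∑ e : Fin M → Fin n → X, (∏ m, w (e m)) *
      confuse s t (e m) (e m') ≤ 2 ^ (-(γ * n)) := by
    intro s t m m' hm'
    have hne : m ≠ m' := (Finset.ne_of_mem_erase hm').symm
    -- Codeword `m'` is independent of codeword `m`, hence of `y`; after resampling, `sum_passes_le`
    -- applies for each fixed `y`.
    rw [sum_pi_resample (fun _ => w) (fun _ => hw1) m']
    calc _ ≤ ∑ e : Fin M → Fin n → X, (∏ m, w (e m)) * 2 ^ (-(γ * n)) := by
          refine Finset.sum_le_sum fun e _ => mul_le_mul_of_nonneg_left ?_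
            (Finset.prod_nonneg fun m _ => hw0 _)
          simp only [Function.update_of_ne hne, Function.update_self, confuse, Finset.mul_sum]
          rw [Finset.sum_comm]
          calc _ ≤ ∑ y : Fin n → Y, (∏ i, chanY p s (e m i) (y i)) * 2 ^ (-(γ * n)) := by
                refine Finset.sum_le_sum fun y _ => ?_
                refine le_trans (le_of_eq ?_) (mul_le_mul_of_nonneg_left
                  (sum_passes_le hN (isChannel_chanY hp t) γ y) (hY0 s (e m) y))
                rw [Finset.mul_sum]
                exact Finset.sum_congr rfl fun x _ => by simp only [w]; ring
            _ = 2 ^ (-(γ * n)) := by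
                rw [← Finset.sum_mul, sum_pi_prod_eq_one (fun i => chanY p s (e m i))
                  (fun i => (isChannel_chanY hp s _).2), one_mul]
      _ = _ := by
          rw [← Finset.sum_mul, sum_pi_prod_eq_one (fun _ => w) (fun _ => hw1), one_mul]
  -- One functional for all requirements. The factor `card S ^ 2` comes from summing over true
  -- states and over tested states.
  let F : (Fin M → Fin n → X) → ℝ := fun e => ∑ s, ∑ m, (fail s (e m) + dev s (e m) +
    ∑ m' ∈ Finset.univ.erase m, ∑ t, confuse s t (e m) (e m'))
  set b : ℝ := (∑ s, (α s + (Fintype.card Z : ℝ) ^ 2)) / n +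
    Fintype.card S ^ 2 * (((M : ℝ) - 1) * 2 ^ (-(γ * n))) with hb
  have hF : ∑ e, (∏ m, w (e m)) * F e ≤ M * b := by
    calc ∑ e, (∏ m, w (e m)) * F e = ∑ s, ∑ m : Fin M,
          (∑ e : Fin M → Fin n → X, (∏ m, w (e m)) * fail s (e m) +
            ∑ e : Fin M → Fin n → X, (∏ m, w (e m)) * dev s (e m) +
            ∑ m' ∈ Finset.univ.erase m, ∑ t,
              ∑ e : Fin M → Fin n → X, (∏ m, w (e m)) * confuse s t (e m) (e m')) := by
          simp only [F, Finset.mul_sum, mul_add, Finset.sum_add_distrib]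
          simp only [Finset.sum_comm (s := (Finset.univ : Finset (Fin M → Fin n → X)))]
      _ ≤ ∑ s, ∑ m : Fin M, (α s / n + (Fintype.card Z : ℝ) ^ 2 / n +
            ∑ m' ∈ Finset.univ.erase m, ∑ t : S, 2 ^ (-(γ * n))) :=
          Finset.sum_le_sum fun s _ => Finset.sum_le_sum fun m _ =>
            add_le_add (add_le_add (Efail s m) (Edev s m)) (Finset.sum_le_sum fun m' hm' =>
              Finset.sum_le_sum fun t _ => Econf s t m m' hm')
      _ = M * b := by
          have hcard : ((M - 1 : ℕ) : ℝ) = (M : ℝ) - 1 := by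
            rw [Nat.cast_sub hM, Nat.cast_one]
          simp only [Finset.sum_const, Finset.card_univ, Fintype.card_fin, nsmul_eq_mul,
            Finset.card_erase_of_mem (Finset.mem_univ _), hcard, hb, ← add_div]
          rw [← Finset.mul_sum, Finset.sum_add_distrib, ← Finset.sum_div]
          simp only [Finset.sum_const, Finset.card_univ, nsmul_eq_mul]
          ring
  obtain ⟨e, he⟩ := exists_le_of_average_le (w := fun e : Fin M → Fin n → X => ∏ m, w (e m))
    (fun e => Finset.prod_nonneg fun m _ => hw0 _)
    (sum_pi_prod_eq_one (fun _ => w) fun _ => hw1) hF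
  have hconfs : ∀ s m, 0 ≤ ∑ m' ∈ Finset.univ.erase m, ∑ t, confuse s t (e m) (e m') :=
    fun s m => Finset.sum_nonneg fun m' _ => Finset.sum_nonneg fun t _ => hconf0 _ _ _ _
  have hFs : ∀ s, ∑ m, (fail s (e m) + dev s (e m) +
      ∑ m' ∈ Finset.univ.erase m, ∑ t, confuse s t (e m) (e m')) ≤ M * b := fun s =>
    (Finset.single_le_sum (f := fun s => ∑ m, (fail s (e m) + dev s (e m) +
      ∑ m' ∈ Finset.univ.erase m, ∑ t, confuse s t (e m) (e m')))
      (fun s _ => Finset.sum_nonneg fun m _ => add_nonneg (add_nonneg (hfail0 _ _) (hdev0 _ _))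
        (hconfs s m)) (Finset.mem_univ s)).trans he
  refine ⟨thresholdCode p N γ e, fun s => ⟨?_, ?_⟩⟩
  · rw [prob_receiver, div_le_iff₀ hM', mul_comm]
    refine le_trans (Finset.sum_le_sum fun m _ => ?_) (hFs s)
    have h1 : ∑ y : Fin n → Y, (∏ i, chanY p s (e m i) (y i)) *
        (if (thresholdCode p N γ e).dec y ≠ m then (1 : ℝ) else 0) ≤
        fail s (e m) + ∑ m' ∈ Finset.univ.erase m, ∑ t, confuse s t (e m) (e m') := by
      calc _ ≤ ∑ y : Fin n → Y, (∏ i, chanY p s (e m i) (y i)) * _ :=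
            Finset.sum_le_sum fun y _ => mul_le_mul_of_nonneg_left
              (thresholdCode_error_le p N γ e s m y) (hY0 s (e m) y)
        _ = _ := by
            simp only [mul_add, Finset.sum_add_distrib, fail, confuse, Finset.mul_sum]
            rw [Finset.sum_comm (s := (Finset.univ : Finset (Fin n → Y)))]
            congr 1
            refine Finset.sum_congr rfl fun m' _ => ?_
            rw [Finset.sum_comm]
    simp only [mul_ite, mul_one, mul_zero] at h1
    have h2 := hdev0 s (e m)
    refine le_trans (le_of_eq (Finset.sum_congr rfl fun y _ => ?_)) (h1.trans ?_)
    · split_ifs <;> rfl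
    · linarith
  · rw [div_le_iff₀ hM', mul_comm]
    refine le_trans (Finset.sum_le_sum fun m _ => ?_) (hFs s)
    have h1 := hfail0 s (e m)
    have h2 := hconfs s m
    change dev s (e m) ≤ _
    linarith

theorem numMessages_pos (R : ℝ) (n : ℕ) : 0 < numMessages R n :=
  Nat.ceil_pos.2 (by positivity)

theorem numMessages_sub_one_le (R : ℝ) (n : ℕ) :
    (numMessages R n : ℝ) - 1 ≤ 2 ^ ((n : ℝ) * R) := by
  have := Nat.ceil_lt_add_one (show (0 : ℝ) ≤ 2 ^ ((n : ℝ) * R) by positivity)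
  unfold numMessages
  linarith

/-- Stating the rate condition as a limit also covers `R = 0`, where there is one message and `γ`
may be negative. -/
theorem multiplyAchievable_of_tendsto [Nonempty S] {p : X × S → Y × Z → ℝ} (hp : IsChannel p)
    {N : X → ℝ} (hN : N ∈ pmfs X) {γ R : ℝ}
    (hγ : ∀ s, γ < mutualInfo (joint N (chanY p s)))
    (hR : Tendsto (fun n : ℕ => ((numMessages R n : ℝ) - 1) * 2 ^ (-(γ * n))) atTop (𝓝 0)) :
    MultiplyAchievable p R (fun s => output N (chanZ p s)) := by
  obtain ⟨α, hα⟩ := exists_code hp hN hγ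
  choose c hc using fun n : ℕ => hα (numMessages R (n + 1)) (n + 1) (numMessages_pos _ _) n.succ_pos
  set b : ℕ → ℝ := fun n => α / n +
    Fintype.card S ^ 2 * (((numMessages R n : ℝ) - 1) * 2 ^ (-(γ * n))) with hb
  have hb0 : Tendsto b atTop (𝓝 0) := by
    have := (tendsto_const_div_atTop_nhds_zero_nat α).add (hR.const_mul ((Fintype.card S : ℝ) ^ 2))
    simpa using this
  have hX : Nonempty X := by
    by_contra h
    rw [not_nonempty_iff] at h
    simpa using hN.2
  -- The code at blocklength 0 is arbitrary; limits ignore it.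
  let c' : (n : ℕ) → Code X Y (numMessages R n) n := fun n => match n with
    | 0 => ⟨fun _ _ => hX.some, fun _ => ⟨0, numMessages_pos _ _⟩⟩
    | n + 1 => c n
  refine ⟨c', ?_, fun s ε hε => ?_⟩
  · rw [← tendsto_add_atTop_iff_nat 1]
    refine tendsto_of_tendsto_of_tendsto_of_le_of_le tendsto_const_nhds
      ((tendsto_add_atTop_iff_nat 1).2 hb0)
      (fun n => Real.iSup_nonneg fun s => prob_nonneg hp _ _ _)
      (fun n => ciSup_le fun s => (hc n s).1)
  · rw [← tendsto_add_atTop_iff_nat 1]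
    have hlim : Tendsto (fun n => b (n + 1) / ε ^ 2) atTop (𝓝 0) := by
      simpa using ((tendsto_add_atTop_iff_nat 1).2 hb0).div_const (ε ^ 2)
    refine tendsto_of_tendsto_of_tendsto_of_le_of_le tendsto_const_nhds hlim
      (fun n => prob_nonneg hp _ _ _) (fun n => ?_)
    exact (prob_variational_le hp s (c n) _ hε).trans
      (div_le_div_of_nonneg_right (hc n s).2 (by positivity))

theorem multiplyAchievable_of_lt_minInfo [Nonempty S] {p : X × S → Y × Z → ℝ} (hp : IsChannel p)
    {N : X → ℝ} (hN : N ∈ pmfs X) {R : ℝ} (hR : 0 ≤ R) (h : R = 0 ∨ R < minInfo p N) :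
    MultiplyAchievable p R (fun s => output N (chanZ p s)) := by
  rcases h with rfl | h
  · refine multiplyAchievable_of_tendsto hp hN (γ := minInfo p N - 1)
      (fun s => (sub_one_lt _).trans_le (minInfo_le p N s)) ?_
    simp [numMessages]
  · obtain ⟨γ, h1, h2⟩ := exists_between h
    refine multiplyAchievable_of_tendsto hp hN (fun s => h2.trans_le (minInfo_le p N s)) ?_
    have hlt : (2 : ℝ) ^ (R - γ) < 1 :=
      Real.rpow_lt_one_of_one_lt_of_neg (by norm_num) (by linarith)
    refine tendsto_of_tendsto_of_tendsto_of_le_of_le tendsto_const_nhds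
      (tendsto_pow_atTop_nhds_zero_of_lt_one (by positivity) hlt) (fun n => ?_) (fun n => ?_)
    · have : (1 : ℝ) ≤ numMessages R n := by exact_mod_cast numMessages_pos R n
      exact mul_nonneg (by linarith) (by positivity)
    · refine (mul_le_mul_of_nonneg_right (numMessages_sub_one_le R n) (by positivity)).trans
        (le_of_eq ?_)
      rw [← Real.rpow_add (by norm_num), ← Real.rpow_natCast, ← Real.rpow_mul (by norm_num)]
      congr 1
      ring

end Achievability

/-! ### Converse -/

section Converse

variable {X Y Z S : Type*}

/-- The average of the types of the codewords. -/
def Code.meanType {M n : ℕ} (c : Code X Y M n) : X → ℝ :=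
  fun a => (∑ m, seqType (c.enc m) a) / M

theorem Code.meanType_mem_pmfs [Fintype X] {M n : ℕ} (hM : 0 < M) (hn : 0 < n)
    (c : Code X Y M n) : c.meanType ∈ pmfs X := by
  have h := fun m => seqType_mem_pmfs hn (c.enc m)
  refine ⟨fun a => div_nonneg (Finset.sum_nonneg fun m _ => (h m).1 a) (Nat.cast_nonneg _), ?_⟩
  simp only [Code.meanType]
  rw [← Finset.sum_div, Finset.sum_comm]
  have hM' : (M : ℝ) ≠ 0 := by exact_mod_cast hM.ne'
  simp [(h _).2, hM']

theorem Code.meanType_pos {M n : ℕ} (c : Code X Y M n) (m : Fin M) (i : Fin n) :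
    0 < c.meanType (c.enc m i) := by
  have hM : (0 : ℝ) < M := by exact_mod_cast m.pos
  have hn : (0 : ℝ) < n := by exact_mod_cast i.pos
  have hocc : 0 < occ (c.enc m) (c.enc m i) := Finset.card_pos.2 ⟨i, by simp⟩
  have h1 : 0 < seqType (c.enc m) (c.enc m i) := div_pos (by exact_mod_cast hocc) hn
  refine div_pos (h1.trans_le ?_) hM
  exact Finset.single_le_sum (f := fun m' => seqType (c.enc m') (c.enc m i))
    (fun m' _ => by unfold seqType; positivity) (Finset.mem_univ m)

/-- Single-letter sums see the codebook only through its mean type; this single-letterises the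
converse. -/
theorem Code.sum_meanType_mul [Fintype X] {M n : ℕ} (hM : 0 < M) (hn : 0 < n)
    (c : Code X Y M n) (f : X → ℝ) :
    ∑ m, ∑ i, f (c.enc m i) = M * n * ∑ a, c.meanType a * f a := by
  have hM' : (M : ℝ) ≠ 0 := by exact_mod_cast hM.ne'
  have hn' : (n : ℝ) ≠ 0 := by exact_mod_cast hn.ne'
  simp only [← sum_occ_mul, Code.meanType, seqType]
  rw [Finset.sum_comm, Finset.mul_sum]
  refine Finset.sum_congr rfl fun a _ => ?_
  rw [← Finset.sum_mul, ← Finset.sum_div]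
  field_simp

variable [Fintype X] [Fintype Y] [Fintype Z]

open Classical in
/-- A Fano-type inequality in terms of the average codeword type. -/
theorem Code.le_mutualInfo {p : X × S → Y × Z → ℝ} (hp : IsChannel p) (s : S) {M n : ℕ}
    (hM : 0 < M) (hn : 0 < n) (c : Code X Y M n) {r : ℝ} (hr : r ≤ Real.logb 2 M) :
    (1 - prob p s c fun m y _ => c.dec y ≠ m) * r - 1 ≤
      n * mutualInfo (joint c.meanType (chanY p s)) := by
  have hJ := isChannel_chanY hp s
  set J := chanY p s with hJdef
  have hN := c.meanType_mem_pmfs hM hn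
  have hM' : (0 : ℝ) < M := by exact_mod_cast hM
  have hlog2 : (0 : ℝ) < Real.log 2 := Real.log_pos (by norm_num)
  let q := output c.meanType J
  have hq : q ∈ pmfs Y := output_mem_pmfs hN hJ
  let W : Fin M → (Fin n → Y) → ℝ := fun m y => ∏ i, J (c.enc m i) (y i)
  let V : (Fin n → Y) → ℝ := fun y => ∏ i, q (y i)
  let L : Fin M → (Fin n → Y) → ℝ := fun m y =>
    ∑ i, Real.logb 2 (J (c.enc m i) (y i) / q (y i))
  let χ : Fin M → (Fin n → Y) → ℝ := fun m y => if c.dec y = m then 1 else 0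
  have hW0 : ∀ m y, 0 ≤ W m y := fun m y => Finset.prod_nonneg fun i _ => (hJ _).1 _
  have hV0 : ∀ y, 0 ≤ V y := fun y => Finset.prod_nonneg fun i _ => hq.1 _
  have hW1 : ∀ m, ∑ y, W m y = 1 := fun m =>
    sum_pi_prod_eq_one (fun i => J (c.enc m i)) fun i => (hJ _).2
  have hV1 : ∑ y, V y = 1 := sum_pi_prod_eq_one (fun _ => q) fun _ => hq.2
  -- This is `log t ≤ t - 1` at `t = V * e / (2 * W)`, with `e = M` for correct decoding and `e = 1`
  -- otherwise, so `e ≤ χ * M + 1`. The halved weights `V * (χ * M + 1) / 2` have the same total `M`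
  -- as `W`, so the right side sums to 0; the halving costs one bit.
  have hpt : ∀ m y, W m y * (χ m y * Real.log M - Real.log 2 - Real.log 2 * L m y) ≤
      V y * (χ m y * M + 1) / 2 - W m y := by
    intro m y
    rcases (hW0 m y).eq_or_lt with h | h
    · rw [← h, zero_mul, sub_zero]
      have : 0 ≤ χ m y := by simp only [χ]; split_ifs <;> norm_num
      have := hV0 y
      positivity
    have hJi : ∀ i, 0 < J (c.enc m i) (y i) := fun i => ((hJ _).1 _).lt_of_ne'
      (Finset.prod_ne_zero_iff.1 h.ne' i (Finset.mem_univ i))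
    have hqi : ∀ i, 0 < q (y i) := fun i => output_pos hN.1 hJ (c.meanType_pos m i) (hJi i)
    have hVp : 0 < V y := Finset.prod_pos fun i _ => hqi i
    have hL : Real.log 2 * L m y = Real.log (W m y) - Real.log (V y) := by
      simp only [L, W, V]
      rw [Real.log_prod fun i _ => (hJi i).ne', Real.log_prod fun i _ => (hqi i).ne',
        ← Finset.sum_sub_distrib, Finset.mul_sum]
      refine Finset.sum_congr rfl fun i _ => ?_
      rw [Real.logb, Real.log_div (hJi i).ne' (hqi i).ne']
      field_simp
    have hkey : ∀ e : ℝ, 0 < e → W m y * (Real.log e - Real.log 2 - Real.log 2 * L m y) ≤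
        V y * e / 2 - W m y := by
      intro e he
      have h1 := Real.log_le_sub_one_of_pos (show 0 < V y * e / (2 * W m y) by positivity)
      rw [Real.log_div (by positivity) (by positivity), Real.log_mul hVp.ne' he.ne',
        Real.log_mul (by norm_num) h.ne'] at h1
      have h2 := mul_le_mul_of_nonneg_left h1 h.le
      have h3 : W m y * (V y * e / (2 * W m y) - 1) = V y * e / 2 - W m y := by
        field_simp
      rw [h3] at h2
      refine le_trans (le_of_eq ?_) h2
      rw [hL]; ring
    by_cases hd : c.dec y = m
    · simp only [χ, hd, if_true, one_mul]
      refine (hkey M hM').trans ?_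
      have := hVp.le
      linarith
    · simp only [χ, hd, if_false, zero_mul, zero_add]
      simpa using hkey 1 one_pos
  have hχ : ∀ y, ∑ m, χ m y = 1 := fun y => by simp [χ]
  have hright : ∑ m, ∑ y, (V y * (χ m y * M + 1) / 2 - W m y) = 0 := by
    simp only [Finset.sum_sub_distrib, hW1]
    rw [Finset.sum_comm]
    have : ∀ y, ∑ m, V y * (χ m y * M + 1) / 2 = V y * M := fun y => by
      rw [← Finset.sum_div, ← Finset.mul_sum, Finset.sum_add_distrib, ← Finset.sum_mul, hχ]
      simp only [Finset.sum_const, Finset.card_univ, Fintype.card_fin, nsmul_eq_mul]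
      ring
    simp only [this]
    rw [← Finset.sum_mul, hV1]
    simp
  set E := prob p s c fun m y _ => c.dec y ≠ m with hE
  have hcorrect : ∑ m, ∑ y, W m y * χ m y = M * (1 - E) := by
    have h1 : ∑ m, ∑ y, W m y * (1 - χ m y) = M * E := by
      rw [hE, prob_receiver, mul_div_cancel₀ _ hM'.ne']
      refine Finset.sum_congr rfl fun m _ => Finset.sum_congr rfl fun y _ => ?_
      by_cases hd : c.dec y = m <;> simp [χ, hd, W, hJdef]
    simp only [mul_sub, mul_one, Finset.sum_sub_distrib, hW1] at h1
    simp only [Finset.sum_const, Finset.card_univ, Fintype.card_fin, nsmul_eq_mul, mul_one] at h1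
    linarith
  have hE1 : 0 ≤ 1 - E := by
    have h0 : 0 ≤ ∑ m, ∑ y, W m y * χ m y := Finset.sum_nonneg fun m _ =>
      Finset.sum_nonneg fun y _ => mul_nonneg (hW0 m y) (by simp only [χ]; split_ifs <;> norm_num)
    rw [hcorrect] at h0
    exact nonneg_of_mul_nonneg_right h0 hM'
  have hinfo : ∑ m, ∑ y, W m y * L m y = M * (n * mutualInfo (joint c.meanType J)) := by
    rw [mutualInfo_joint _ hJ, ← mul_assoc, ← c.sum_meanType_mul hM hn]
    refine Finset.sum_congr rfl fun m _ => ?_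
    simp only [L, Finset.mul_sum]
    rw [Finset.sum_comm]
    refine Finset.sum_congr rfl fun i _ => ?_
    exact sum_pi_coord (fun i => J (c.enc m i)) (fun i => (hJ _).2) i
      fun b => Real.logb 2 (J (c.enc m i) b / q b)
  have hsum : ∑ m, ∑ y, W m y * (χ m y * Real.log M - Real.log 2 - Real.log 2 * L m y) =
      M * ((1 - E) * Real.log M - Real.log 2 -
        Real.log 2 * (n * mutualInfo (joint c.meanType J))) := by
    calc _ = (∑ m, ∑ y, W m y * χ m y) * Real.log M - (∑ m, ∑ y, W m y) * Real.log 2 -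
          Real.log 2 * ∑ m, ∑ y, W m y * L m y := by
          simp only [Finset.sum_mul, Finset.mul_sum, ← Finset.sum_sub_distrib]
          exact Finset.sum_congr rfl fun m _ => Finset.sum_congr rfl fun y _ => by ring
      _ = _ := by
          rw [hcorrect, hinfo]
          simp only [hW1, Finset.sum_const, Finset.card_univ, Fintype.card_fin, nsmul_eq_mul]
          ring
  have hle : M * ((1 - E) * Real.log M - Real.log 2 -
      Real.log 2 * (n * mutualInfo (joint c.meanType J))) ≤ 0 := by
    rw [← hsum, ← hright]
    exact Finset.sum_le_sum fun m _ => Finset.sum_le_sum fun y _ => hpt m y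
  have hle' := nonpos_of_mul_nonpos_right hle hM'
  have hlogM : Real.log M = Real.log 2 * Real.logb 2 M := by
    rw [Real.logb]; field_simp
  rw [hlogM] at hle'
  have h1 : Real.log 2 * ((1 - E) * Real.logb 2 M - 1 -
      n * mutualInfo (joint c.meanType J)) ≤ 0 := by linarith
  have h2 := nonpos_of_mul_nonpos_right h1 hlog2
  have h3 := mul_le_mul_of_nonneg_left hr hE1
  linarith

-- The output of the mean type is the expected interference type; its deviation is below `ε` off the
-- bad event and at most 1 on it.
open Classical in
theorem Code.abs_output_sub_le {p : X × S → Y × Z → ℝ} (hp : IsChannel p) (s : S) {M n : ℕ}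
    (hM : 0 < M) (hn : 0 < n) (c : Code X Y M n) {Q : Z → ℝ} (hQ : Q ∈ pmfs Z) {ε : ℝ}
    (hε : 0 < ε) (k : Z) :
    |output c.meanType (chanZ p s) k - Q k| ≤
      ε + prob p s c fun _ _ z => ε ≤ variational Q (seqType z) := by
  have hK := isChannel_chanZ hp s
  have hM' : (0 : ℝ) < M := by exact_mod_cast hM
  have hn' : (0 : ℝ) < n := by exact_mod_cast hn
  let W : Fin M → (Fin n → Z) → ℝ := fun m z => ∏ i, chanZ p s (c.enc m i) (z i)
  have hW0 : ∀ m z, 0 ≤ W m z := fun m z => Finset.prod_nonneg fun i _ => (hK _).1 _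
  have hW1 : ∀ m, ∑ z, W m z = 1 := fun m =>
    sum_pi_prod_eq_one (fun i => chanZ p s (c.enc m i)) fun i => (hK _).2
  have hmean : ∑ m, ∑ z, W m z * (seqType z k - Q k) =
      M * (output c.meanType (chanZ p s) k - Q k) := by
    have h1 : ∀ m, ∑ z, W m z * seqType z k = (∑ i, chanZ p s (c.enc m i) k) / n := by
      intro m
      simp only [seqType, occ_eq_sum, ← mul_div_assoc, Finset.mul_sum]
      rw [← Finset.sum_div, Finset.sum_comm]
      congr 1
      refine Finset.sum_congr rfl fun i _ => ?_
      rw [sum_pi_coord (fun i => chanZ p s (c.enc m i)) (fun i => (hK _).2) i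
        fun b => if b = k then (1 : ℝ) else 0]
      simp
    simp only [mul_sub, Finset.sum_sub_distrib, h1, ← Finset.sum_mul, hW1]
    rw [← Finset.sum_div, c.sum_meanType_mul hM hn fun a => chanZ p s a k]
    simp only [Finset.sum_const, Finset.card_univ, Fintype.card_fin, nsmul_eq_mul, output]
    field_simp
  have hpt : ∀ z : Fin n → Z, |seqType z k - Q k| ≤
      ε + if ε ≤ variational Q (seqType z) then 1 else 0 := by
    intro z
    split_ifs with h
    · have hz := seqType_mem_pmfs hn z
      have h1 := pmf_le_one hz k
      have h2 := pmf_le_one hQ k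
      have h3 := hz.1 k
      have h4 := hQ.1 k
      rw [abs_le]; constructor <;> linarith
    · rw [add_zero, abs_sub_comm]
      refine le_trans ?_ (not_le.1 h).le
      exact Finset.single_le_sum (f := fun k => |Q k - seqType z k|)
        (fun _ _ => abs_nonneg _) (Finset.mem_univ k)
  rw [prob_observer]
  have hdiv : output c.meanType (chanZ p s) k - Q k =
      (∑ m, ∑ z, W m z * (seqType z k - Q k)) / M := by
    rw [hmean, mul_div_cancel_left₀ _ hM'.ne']
  rw [hdiv, abs_div, abs_of_pos hM', div_le_iff₀ hM', add_mul, div_mul_cancel₀ _ hM'.ne']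
  calc |∑ m, ∑ z, W m z * (seqType z k - Q k)|
      ≤ ∑ m, ∑ z, |W m z * (seqType z k - Q k)| :=
        (Finset.abs_sum_le_sum_abs _ _).trans
          (Finset.sum_le_sum fun m _ => Finset.abs_sum_le_sum_abs _ _)
    _ ≤ ∑ m, ∑ z, (W m z * ε + if ε ≤ variational Q (seqType z) then W m z else 0) := by
        refine Finset.sum_le_sum fun m _ => Finset.sum_le_sum fun z _ => ?_
        rw [abs_mul, abs_of_nonneg (hW0 m z)]
        refine (mul_le_mul_of_nonneg_left (hpt z) (hW0 m z)).trans (le_of_eq ?_)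
        rw [mul_add, mul_ite, mul_one, mul_zero]
    _ = _ := by
        simp only [Finset.sum_add_distrib, ← Finset.sum_mul, hW1]
        simp [W, mul_comm]

/-- One convergent subsequence of mean types serves all states, so the same `N` meets every output
constraint and every rate bound. -/
theorem exists_input_of_multiplyAchievable [Finite S] [Nonempty S] {p : X × S → Y × Z → ℝ}
    (hp : IsChannel p) {R : ℝ} {Q : S → Z → ℝ} (hQ : ∀ s, Q s ∈ pmfs Z)
    (h : MultiplyAchievable p R Q) :
    ∃ N ∈ pmfs X, (∀ s, output N (chanZ p s) = Q s) ∧ R ≤ minInfo p N := by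
  obtain ⟨c, herr, hdev⟩ := h
  have hmem : ∀ n, (c (n + 1)).meanType ∈ pmfs X := fun n =>
    (c (n + 1)).meanType_mem_pmfs (numMessages_pos _ _) n.succ_pos
  obtain ⟨N, hN, φ, hφ, hlim⟩ := isCompact_pmfs.tendsto_subseq hmem
  have hψ : Tendsto (fun n => φ n + 1) atTop atTop :=
    (tendsto_add_atTop_nat 1).comp hφ.tendsto_atTop
  refine ⟨N, hN, fun s => ?_, le_ciInf fun s => ?_⟩
  · funext k
    have h1 : Tendsto (fun n => output (c (φ n + 1)).meanType (chanZ p s) k) atTop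
        (𝓝 (output N (chanZ p s) k)) :=
      (((continuous_apply k).comp (continuous_output (chanZ p s))).tendsto N).comp hlim
    have h2 : |output N (chanZ p s) k - Q s k| ≤ 0 := by
      refine le_of_forall_pos_le_add fun ε hε => ?_
      have h3 := ((hdev s ε hε).comp hψ).const_add ε
      rw [add_zero] at h3
      rw [zero_add]
      exact le_of_tendsto_of_tendsto' (h1.sub_const _).abs h3 fun n =>
        (c (φ n + 1)).abs_output_sub_le hp s (numMessages_pos _ _) (Nat.succ_pos _) (hQ s) hε k
    exact sub_eq_zero.1 (abs_nonpos_iff.1 h2)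
  · have herr_s : Tendsto (fun n => prob p s (c n) fun m y _ => (c n).dec y ≠ m) atTop (𝓝 0) :=
      tendsto_of_tendsto_of_tendsto_of_le_of_le tendsto_const_nhds herr
        (fun n => prob_nonneg hp _ _ _) fun n =>
          le_ciSup (f := fun s => prob p s (c n) fun m y _ => (c n).dec y ≠ m)
            (Set.finite_range _).bddAbove s
    have hI : Tendsto (fun n => mutualInfo (joint (c (φ n + 1)).meanType (chanY p s))) atTop
        (𝓝 (mutualInfo (joint N (chanY p s)))) :=
      (continuousOn_mutualInfo (isChannel_chanY hp s) N hN).tendsto.comp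
        (tendsto_nhdsWithin_iff.2 ⟨hlim, Eventually.of_forall fun n => hmem _⟩)
    have hL : Tendsto (fun n : ℕ => (1 - prob p s (c n) fun m y _ => (c n).dec y ≠ m) * R - 1 / n)
        atTop (𝓝 R) := by
      simpa using ((herr_s.const_sub 1).mul_const R).sub (tendsto_const_div_atTop_nhds_zero_nat 1)
    refine le_of_tendsto_of_tendsto' (hL.comp hψ) hI fun n => ?_
    have hn : (0 : ℝ) < ((φ n + 1 : ℕ) : ℝ) := by positivity
    have hr : ((φ n + 1 : ℕ) : ℝ) * R ≤ Real.logb 2 (numMessages R (φ n + 1)) := by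
      rw [Real.le_logb_iff_rpow_le (by norm_num) (by exact_mod_cast numMessages_pos _ _)]
      exact Nat.le_ceil _
    have hle := (c (φ n + 1)).le_mutualInfo hp s (numMessages_pos _ _) (Nat.succ_pos _) hr
    simp only [Function.comp]
    rw [← mul_le_mul_iff_right₀ hn]
    refine le_trans (le_of_eq ?_) hle
    field_simp

end Converse

end CompoundInterference

end

open CompoundInterference in
theorem theorem1 {X Y Z S : Type*} [Fintype X] [Fintype Y] [Fintype Z] [Fintype S] [Nonempty S]
    (p : X × S → Y × Z → ℝ) (hp : p ∈ condTypes (X × S) (Y × Z)) :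
    capacityRegion p =
        closure {t : ℝ × (S → Z → ℝ) | 0 ≤ t.1 ∧ (∀ s, t.2 s ∈ types Z) ∧
          (commonPreimage p t.2).Nonempty ∧ t.1 ≤ sSup (minInfo p '' commonPreimage p t.2)} ∧
      ∀ Q : S → Z → ℝ, (∀ s, Q s ∈ types Z) → (commonPreimage p Q).Nonempty →
        ∃ v : ℝ, IsLUB (minInfo p '' commonPreimage p Q) v ∧
          IsGreatest (minInfo p '' {N | N ∈ pmfs X ∧ ∀ s, output N (chanZ p s) = Q s}) v := by
  have hch := isChannel_of_mem_condTypes hp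
  refine ⟨Set.Subset.antisymm (closure_mono ?_) (closure_minimal ?_ isClosed_closure),
    fun Q hQ hne => exists_isLUB_isGreatest_minInfo hp hQ hne⟩
  · rintro ⟨R, Q⟩ ⟨hR, hQ, hach⟩
    obtain ⟨N, hN, hNQ, hle⟩ :=
      exists_input_of_multiplyAchievable hch (fun s => types_subset_pmfs (hQ s)) hach
    have hne : (commonPreimage p Q).Nonempty :=
      closure_nonempty_iff.1 ⟨N, commonPreimage_near hp hQ hN hNQ⟩
    obtain ⟨v, hlub, hgr⟩ := exists_isLUB_isGreatest_minInfo hp hQ hne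
    refine ⟨hR, hQ, hne, ?_⟩
    rw [hlub.csSup_eq (hne.image _)]
    exact hle.trans (hgr.2 ⟨N, ⟨hN, hNQ⟩, rfl⟩)
  · rintro ⟨R, Q⟩ ⟨hR, hQ, hne, hle⟩
    simp only at hR hQ hne hle
    obtain ⟨v, hlub, ⟨N, ⟨hN, hNQ⟩, hv⟩, -⟩ := exists_isLUB_isGreatest_minInfo hp hQ hne
    rw [hlub.csSup_eq (hne.image _), ← hv] at hle
    have hQeq : (fun s => output N (chanZ p s)) = Q := funext hNQ
    have hach : ∀ R', 0 ≤ R' → (R' = 0 ∨ R' < minInfo p N) → MultiplyAchievable p R' Q :=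
      fun R' h0 h => hQeq ▸ multiplyAchievable_of_lt_minInfo hch hN h0 h
    rcases hR.eq_or_lt with h0 | h0
    · exact subset_closure ⟨hR, hQ, hach R hR (Or.inl h0.symm)⟩
    -- Random coding needs a rate strictly below `minInfo p N`; the boundary rate is reached only in
    -- the closure.
    · have hcl : R ∈ closure (Set.Ico 0 R) := by
        rw [closure_Ico h0.ne]
        exact ⟨hR, le_rfl⟩
      refine map_mem_closure (f := fun R' : ℝ => (R', Q)) (by fun_prop) hcl ?_
      exact fun R' hR' => ⟨hR'.1, hQ, hach R' hR'.1 (Or.inr (hR'.2.trans_le hle))⟩
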